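/- **Setting.** Names form a countable set containing a special channel $\mathit{out}$ and, as special names, the natural numbers; $\mathit{out}$ and the numbers are never used as bound names. The mixed-choice $\pi$-calculus $\pi_m$ has the processes $P ::= \sum_i \alpha_i.P_i \mid \nu x P \mid P|P \mid {!P}$ (finite sums) with prefixes $\alpha ::= x(y) \mid \bar x y \mid \tau$. The separate-choice $\pi$-calculus $\pi_s$ is the subset in which no sum, at any depth, has both an input and an output summand. Processes are taken up to alpha-conversion $\equiv_\alpha$. The semantics is the early labelled transition system (labels $xy$, $\bar x y$, $\bar x(y)$, $\tau$), with a rule closing transitions under the congruence $\equiv$ generated by alpha-conversion and $(\nu x P)|Q \equiv \nu x (P|Q)$ for $x\notin \mathrm{fn}(Q)$. A *network* $P=[P_0|\dots|P_{k-1}]$ consists of distinct globally bound names $x_0,\dots,x_{n-1}$ and processes $P_0,\dots,P_{k-1}$; it represents $\nu x_0\cdots\nu x_{n-1}(P_0|\dots|P_{k-1})$. A *computation* of $P$ is a finite or $\omega$-infinite sequence of labelled transitions from $P$ through networks of $k$ components (the names bound at the top level may be alpha-converted and, after each transition, $\equiv$ may be used to restore the form of a network). The *projection* $\mathrm{Proj}(C,i)$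 of a computation $C$ is the sequence of actions that component $i$ performs in it, alone or in a communication with another component. An *extension* of $C$ is $C$ itself or, if $C$ is finite, a computation obtained by continuing $C$. $P$ is an *electoral system* if every computation $C$ of $P$ has an extension $C'$ for which there is $n\in\{0,\dots,k-1\}$ such that for every $i\in\{0,\dots,k-1\}$ the projection $\mathrm{Proj}(C',i)$ contains an action $\overline{\mathit{out}}\,n$, and no extension of $C'$ contains a transition with label $\overline{\mathit{out}}\,m$ for a number $m\neq n$. The hypergraph $H(P)$ has the nodes $N=\{0,\dots,k-1\}$ and the edges $X=\mathrm{fn}(P_0|\dots|P_{k-1})\setminus\{\mathit{out}\}$, where $x\in X$ connects the set of nodes $t(x)=\{i : x\in \mathrm{fn}(P_i)\}$. An *automorphism* $\sigma$ of $P$ is a pair of permutations $\sigma_N$ of $N$ and $\sigma_X$ of $X$ such that $t(\sigma_X(x))=\sigma_N(t(x))$ for all $x\in X$, $\sigma_X(n)=\sigma_N(n)$ for all $n\in N\cap X$, and $x\in\{x_0,\dots,x_{n-1}\}$ if and only if $\sigma_X(x)\in\{x_0,\dots,x_{n-1}\}$ for all $x\in X$. Its orbits are the orbits of $\sigma_N$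 on $N$. $P$ is *symmetric with respect to* $\sigma$ if $P_{\sigma(i)}\equiv_\alpha\sigma(P_i)$ for every $i\in N$, where $\sigma(P_i)$ renames the free names of $P_i$ by $\sigma_X$ and leaves $\mathit{out}$ unchanged. **Theorem.** Let $P=[P_0|\dots|P_{k-1}]$ be a network in $\pi_s$ with $k\ge 2$. Assume that $P$ has an automorphism $\sigma$ with only one orbit and that $P$ is symmetric with respect to $\sigma$. Then $P$ is not an electoral system. -/

import Mathlib

namespace PiCalc

/-! ### Names and terms

Terms are alpha-equivalence classes: free names are written as names and bound names as de Bruijn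
indices, so that syntactic equality of terms is alpha-equivalence. -/

/-- The countable set of names: the special channel `out`, the names denoted by the natural
numbers, and all the other names. -/
inductive Name : Type
  | out : Name
  | num : ℕ → Name
  | var : ℕ → Name
  deriving DecidableEq

/-- Names other than `out` and the numbers. Only these are used as bound names. -/
def Name.IsVar : Name → Prop
  | .var _ => True
  | _ => False

/-- An occurrence of a name below `n` binders: a free name or a de Bruijn index. -/
inductive Ref (n : ℕ) : Type
  | free : Name → Ref n
  | bound : Fin n → Ref n

mutual
/-- Terms of the mixed-choice calculus with `n` enclosing binders (closed terms: `n = 0`).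
`nu` and the input prefix bind index `0` in their body. -/
inductive Proc : ℕ → Type
  | sum {n : ℕ} : Choice n → Proc n
  | nu {n : ℕ} : Proc (n + 1) → Proc n
  | par {n : ℕ} : Proc n → Proc n → Proc n
  | rep {n : ℕ} : Proc n → Proc n
/-- Finite guarded sums, as lists of the summands `x(y).P`, `x̄y.P` and `τ.P`. -/
inductive Choice : ℕ → Type
  | nil {n : ℕ} : Choice n
  | inp {n : ℕ} (x : Ref n) (P : Proc (n + 1)) (S : Choice n) : Choice n
  | out {n : ℕ} (x y : Ref n) (P : Proc n) (S : Choice n) : Choice n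
  | tau {n : ℕ} (P : Proc n) (S : Choice n) : Choice n
end

/-- A single summand of a guarded sum. -/
inductive Branch (n : ℕ) : Type
  | inp (x : Ref n) (P : Proc (n + 1)) : Branch n
  | out (x y : Ref n) (P : Proc n) : Branch n
  | tau (P : Proc n) : Branch n

/-- The summands of a guarded sum. -/
def Choice.branches : {n : ℕ} → Choice n → List (Branch n)
  | _, .nil => []
  | _, .inp x P S => .inp x P :: S.branches
  | _, .out x y P S => .out x y P :: S.branches
  | _, .tau P S => .tau P :: S.branches

/-- The inactive term, i.e. the empty sum. -/
def Proc.zero : Proc 0 := .sum .nil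

/-! ### Renaming, restriction of a name, free names -/

def Ref.weaken {n : ℕ} : Ref n → Ref (n + 1)
  | .free a => .free a
  | .bound i => .bound i.succ

/-- Extension of a renaming below one more binder. -/
def Ref.lift {n m : ℕ} (ρ : Ref n → Ref m) : Ref (n + 1) → Ref (m + 1)
  | .free a => (ρ (.free a)).weaken
  | .bound i => Fin.cases (.bound 0) (fun j => (ρ (.bound j)).weaken) i

mutual
/-- Capture-avoiding renaming. -/
def Proc.rename : {n m : ℕ} → (Ref n → Ref m) → Proc n → Proc m
  | _, _, ρ, .sum S => .sum (S.rename ρ)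
  | _, _, ρ, .nu P => .nu (P.rename (Ref.lift ρ))
  | _, _, ρ, .par P Q => .par (P.rename ρ) (Q.rename ρ)
  | _, _, ρ, .rep P => .rep (P.rename ρ)
def Choice.rename : {n m : ℕ} → (Ref n → Ref m) → Choice n → Choice m
  | _, _, _, .nil => .nil
  | _, _, ρ, .inp x P S => .inp (ρ x) (P.rename (Ref.lift ρ)) (S.rename ρ)
  | _, _, ρ, .out x y P S => .out (ρ x) (ρ y) (P.rename ρ) (S.rename ρ)
  | _, _, ρ, .tau P S => .tau (P.rename ρ) (S.rename ρ)
end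

/-- `P` regarded as a term below one more binder, whose name does not occur in `P`. -/
def Proc.weaken {n : ℕ} (P : Proc n) : Proc (n + 1) := P.rename Ref.weaken

/-- Apply a map of names to the free names of a term (without capture). -/
def Proc.mapNames {n : ℕ} (f : Name → Name) (P : Proc n) : Proc n :=
  P.rename fun
    | .free a => .free (f a)
    | .bound i => .bound i

/-- `P{y/z}`, for a term `P` below a binder for `z`. -/
def Proc.inst (y : Name) (P : Proc 1) : Proc 0 :=
  P.rename fun
    | .free a => .free a
    | .bound _ => .free y

/-- Turn the free name `y` into the name of an enclosing binder. -/
def Proc.close (y : Name) (P : Proc 0) : Proc 1 :=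
  P.rename fun
    | .free a => if a = y then .bound 0 else .free a
    | .bound i => i.elim0

/-- The restriction `ν y P` of the name `y`. -/
def Proc.res (y : Name) (P : Proc 0) : Proc 0 := .nu (P.close y)

def Ref.fn {n : ℕ} : Ref n → Finset Name
  | .free a => {a}
  | .bound _ => ∅

mutual
/-- The free names of a term. -/
def Proc.fn : {n : ℕ} → Proc n → Finset Name
  | _, .sum S => S.fn
  | _, .nu P => P.fn
  | _, .par P Q => P.fn ∪ Q.fn
  | _, .rep P => P.fn
def Choice.fn : {n : ℕ} → Choice n → Finset Name
  | _, .nil => ∅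
  | _, .inp x P S => x.fn ∪ P.fn ∪ S.fn
  | _, .out x y P S => x.fn ∪ y.fn ∪ P.fn ∪ S.fn
  | _, .tau P S => P.fn ∪ S.fn
end

/-! ### The separate-choice calculus -/

def Branch.IsInp {n : ℕ} : Branch n → Prop
  | .inp _ _ => True
  | _ => False

def Branch.IsOut {n : ℕ} : Branch n → Prop
  | .out _ _ _ => True
  | _ => False

mutual
/-- Membership in the separate-choice calculus: no guarded sum, at any depth, has both input and
output summands. -/
def Proc.IsSeparate : {n : ℕ} → Proc n → Prop
  | _, .sum S =>
      ((∀ b ∈ S.branches, ¬ b.IsOut) ∨ (∀ b ∈ S.branches, ¬ b.IsInp)) ∧ S.IsSeparate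
  | _, .nu P => P.IsSeparate
  | _, .par P Q => P.IsSeparate ∧ Q.IsSeparate
  | _, .rep P => P.IsSeparate
def Choice.IsSeparate : {n : ℕ} → Choice n → Prop
  | _, .nil => True
  | _, .inp _ P S => P.IsSeparate ∧ S.IsSeparate
  | _, .out _ _ P S => P.IsSeparate ∧ S.IsSeparate
  | _, .tau P S => P.IsSeparate ∧ S.IsSeparate
end

/-! ### Structural congruence and the early transition system -/

mutual
/-- The least congruence containing scope expansion `(ν x P) | Q ≡ ν x (P | Q)`, `x ∉ fn(Q)`
(and alpha-conversion, which is equality here). -/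
inductive SCong : {n : ℕ} → Proc n → Proc n → Prop
  | refl {n : ℕ} (P : Proc n) : SCong P P
  | symm {n : ℕ} {P Q : Proc n} : SCong P Q → SCong Q P
  | trans {n : ℕ} {P Q R : Proc n} : SCong P Q → SCong Q R → SCong P R
  | scope {n : ℕ} (P : Proc (n + 1)) (Q : Proc n) :
      SCong (.par (.nu P) Q) (.nu (.par P Q.weaken))
  | sum {n : ℕ} {S T : Choice n} : SCongChoice S T → SCong (.sum S) (.sum T)
  | nu {n : ℕ} {P Q : Proc (n + 1)} : SCong P Q → SCong (.nu P) (.nu Q)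
  | par {n : ℕ} {P P' Q Q' : Proc n} : SCong P P' → SCong Q Q' → SCong (.par P Q) (.par P' Q')
  | rep {n : ℕ} {P Q : Proc n} : SCong P Q → SCong (.rep P) (.rep Q)
/-- Summand-wise structural congruence of guarded sums. -/
inductive SCongChoice : {n : ℕ} → Choice n → Choice n → Prop
  | nil {n : ℕ} : SCongChoice (.nil : Choice n) .nil
  | inp {n : ℕ} (x : Ref n) {P Q : Proc (n + 1)} {S T : Choice n} :
      SCong P Q → SCongChoice S T → SCongChoice (.inp x P S) (.inp x Q T)
  | out {n : ℕ} (x y : Ref n) {P Q : Proc n} {S T : Choice n} :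
      SCong P Q → SCongChoice S T → SCongChoice (.out x y P S) (.out x y Q T)
  | tau {n : ℕ} {P Q : Proc n} {S T : Choice n} :
      SCong P Q → SCongChoice S T → SCongChoice (.tau P S) (.tau Q T)
end

/-- Actions: input `x y`, free output `x̄ y`, bound output `x̄(y)` and `τ`. -/
inductive Act : Type
  | inp (x y : Name) : Act
  | out (x y : Name) : Act
  | bout (x y : Name) : Act
  | tau : Act

/-- The bound names of an action. -/
def Act.bn : Act → Finset Name
  | .bout _ y => {y}
  | _ => ∅

/-- All the names of an action. -/
def Act.names : Act → Finset Name
  | .inp x y => {x, y}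
  | .out x y => {x, y}
  | .bout x y => {x, y}
  | .tau => ∅

/-- The early transition system. -/
inductive Trans : Proc 0 → Act → Proc 0 → Prop
  | inp {S : Choice 0} {x : Name} {P : Proc 1} (y : Name) :
      .inp (.free x) P ∈ S.branches → Trans (.sum S) (.inp x y) (P.inst y)
  | out {S : Choice 0} {x y : Name} {P : Proc 0} :
      .out (.free x) (.free y) P ∈ S.branches → Trans (.sum S) (.out x y) P
  | tau {S : Choice 0} {P : Proc 0} :
      .tau P ∈ S.branches → Trans (.sum S) .tau P
  | opn {P P' : Proc 0} {x y : Name} :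
      Trans P (.out x y) P' → x ≠ y → Trans (.res y P) (.bout x y) P'
  | res {P P' : Proc 0} {μ : Act} {y : Name} :
      Trans P μ P' → y ∉ μ.names → Trans (.res y P) μ (.res y P')
  | parL {P P' Q : Proc 0} {μ : Act} :
      Trans P μ P' → Disjoint μ.bn Q.fn → Trans (.par P Q) μ (.par P' Q)
  | parR {P Q Q' : Proc 0} {μ : Act} :
      Trans Q μ Q' → Disjoint μ.bn P.fn → Trans (.par P Q) μ (.par P Q')
  | comL {P P' Q Q' : Proc 0} {x y : Name} :
      Trans P (.inp x y) P' → Trans Q (.out x y) Q' → Trans (.par P Q) .tau (.par P' Q')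
  | comR {P P' Q Q' : Proc 0} {x y : Name} :
      Trans P (.out x y) P' → Trans Q (.inp x y) Q' → Trans (.par P Q) .tau (.par P' Q')
  | closeL {P P' Q Q' : Proc 0} {x y : Name} :
      Trans P (.inp x y) P' → Trans Q (.bout x y) Q' → y ∉ P.fn →
        Trans (.par P Q) .tau (.res y (.par P' Q'))
  | closeR {P P' Q Q' : Proc 0} {x y : Name} :
      Trans P (.bout x y) P' → Trans Q (.inp x y) Q' → y ∉ Q.fn →
        Trans (.par P Q) .tau (.res y (.par P' Q'))
  | rep {P P' : Proc 0} {μ : Act} :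
      Trans (.par P (.rep P)) μ P' → Trans (.rep P) μ P'
  | cong {P P' Q Q' : Proc 0} {μ : Act} :
      SCong P' P → Trans P μ Q → SCong Q Q' → Trans P' μ Q'

/-! ### Networks -/

/-- A network `ν x₀ … ν xₙ₋₁ (P₀ | … | Pₖ₋₁)`: the globally bound names and the components. The
channel `out` and the numbers are never bound, and the bound names are distinct. -/
structure Network (k : ℕ) where
  bound : List Name
  comp : Fin k → Proc 0
  bound_nodup : bound.Nodup
  bound_isVar : ∀ x ∈ bound, x.IsVar

/-- `P₀ | … | Pₖ₋₁`, associated to the left. -/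
def parAll : {k : ℕ} → (Fin k → Proc 0) → Proc 0
  | 0, _ => .zero
  | 1, P => P 0
  | _ + 2, P => .par (parAll (Fin.init P)) (P (Fin.last _))

/-- `ν x₀ … ν xₙ₋₁ P`. -/
def resAll (xs : List Name) (P : Proc 0) : Proc 0 := xs.foldr Proc.res P

namespace Network

variable {k : ℕ}

/-- The term that a network represents. -/
def toProc (N : Network k) : Proc 0 := resAll N.bound (parAll N.comp)

/-- All components belong to the separate-choice calculus. -/
def IsSeparate (N : Network k) : Prop := ∀ i, (N.comp i).IsSeparate

/-- `N'` is obtained from `N` by alpha-conversion of the globally bound names: the names are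
permuted in such a way that the free names of the network stay fixed. -/
def AlphaEquiv (N N' : Network k) : Prop :=
  ∃ π : Equiv.Perm Name,
    (∀ a ∈ (parAll N.comp).fn, a ∉ N.bound → π a = a) ∧
    N'.bound = N.bound.map π ∧
    ∀ i, N'.comp i = (N.comp i).mapNames π

end Network

/-- `ParDeriv P μ c R`: there is a proof tree of the transition `P₀ | … | Pₖ₋₁ --μ--> R` that has a
node `Pᵢ --μᵢ--> Rᵢ` for each active component `i` (recorded by `c i = some μᵢ`) and none for each
idle component (recorded by `c i = none`). The constructors are the rules of the transition system
for the parallel operator. -/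
inductive ParDeriv : {k : ℕ} → (Fin k → Proc 0) → Act → (Fin k → Option Act) → Proc 0 → Prop
  | comp {P : Fin 1 → Proc 0} {c : Fin 1 → Option Act} {μ : Act} {R : Proc 0} :
      Trans (P 0) μ R → c 0 = some μ → ParDeriv P μ c R
  | parL {k : ℕ} {P : Fin (k + 2) → Proc 0} {c : Fin (k + 2) → Option Act} {μ : Act} {R : Proc 0} :
      ParDeriv (Fin.init P) μ (Fin.init c) R → c (Fin.last _) = none →
      Disjoint μ.bn (P (Fin.last _)).fn →
        ParDeriv P μ c (.par R (P (Fin.last _)))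
  | parR {k : ℕ} {P : Fin (k + 2) → Proc 0} {c : Fin (k + 2) → Option Act} {μ : Act} {R : Proc 0} :
      Trans (P (Fin.last _)) μ R → c (Fin.last _) = some μ → (∀ i, Fin.init c i = none) →
      Disjoint μ.bn (parAll (Fin.init P)).fn →
        ParDeriv P μ c (.par (parAll (Fin.init P)) R)
  | comL {k : ℕ} {P : Fin (k + 2) → Proc 0} {c : Fin (k + 2) → Option Act} {x y : Name}
      {R R' : Proc 0} :
      ParDeriv (Fin.init P) (.inp x y) (Fin.init c) R →
      Trans (P (Fin.last _)) (.out x y) R' → c (Fin.last _) = some (.out x y) →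
        ParDeriv P .tau c (.par R R')
  | comR {k : ℕ} {P : Fin (k + 2) → Proc 0} {c : Fin (k + 2) → Option Act} {x y : Name}
      {R R' : Proc 0} :
      ParDeriv (Fin.init P) (.out x y) (Fin.init c) R →
      Trans (P (Fin.last _)) (.inp x y) R' → c (Fin.last _) = some (.inp x y) →
        ParDeriv P .tau c (.par R R')
  | closeL {k : ℕ} {P : Fin (k + 2) → Proc 0} {c : Fin (k + 2) → Option Act} {x y : Name}
      {R R' : Proc 0} :
      ParDeriv (Fin.init P) (.inp x y) (Fin.init c) R →
      Trans (P (Fin.last _)) (.bout x y) R' → c (Fin.last _) = some (.bout x y) →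
      y ∉ (parAll (Fin.init P)).fn →
        ParDeriv P .tau c (.res y (.par R R'))
  | closeR {k : ℕ} {P : Fin (k + 2) → Proc 0} {c : Fin (k + 2) → Option Act} {x y : Name}
      {R R' : Proc 0} :
      ParDeriv (Fin.init P) (.bout x y) (Fin.init c) R →
      Trans (P (Fin.last _)) (.inp x y) R' → c (Fin.last _) = some (.inp x y) →
      y ∉ (P (Fin.last _)).fn →
        ParDeriv P .tau c (.res y (.par R R'))

/-- Proof trees, as before, of the transitions `ν x₀ … ν xₙ₋₁ (P₀ | … | Pₖ₋₁) --μ--> R`; the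
constructors `res` and `opn` are the rules for restriction. -/
inductive NetDeriv {k : ℕ} (P : Fin k → Proc 0) :
    List Name → Act → (Fin k → Option Act) → Proc 0 → Prop
  | par {μ : Act} {c : Fin k → Option Act} {R : Proc 0} :
      ParDeriv P μ c R → NetDeriv P [] μ c R
  | res {x : Name} {xs : List Name} {μ : Act} {c : Fin k → Option Act} {R : Proc 0} :
      NetDeriv P xs μ c R → x ∉ μ.names → NetDeriv P (x :: xs) μ c (.res x R)
  | opn {z x : Name} {xs : List Name} {c : Fin k → Option Act} {R : Proc 0} :
      NetDeriv P xs (.out z x) c R → z ≠ x → NetDeriv P (x :: xs) (.bout z x) c R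

namespace Network

variable {k : ℕ}

/-- A step of a network, with label `μ` and contributions `c` of the components: a transition whose
source may be alpha-converted and whose target is brought back by structural congruence to the form
of a network of `k` components. Neither `out` nor a number is used as a bound name. -/
def Step (N : Network k) (μ : Act) (c : Fin k → Option Act) (N' : Network k) : Prop :=
  (∀ y ∈ μ.bn, y.IsVar) ∧
  ∃ (M : Network k) (R : Proc 0),
    N.AlphaEquiv M ∧ NetDeriv M.comp M.bound μ c R ∧ SCong R N'.toProc

/-- A finite or `ω`-infinite computation of the network `P`, with `len` steps; `contrib m i` is the
action contributed by component `i` to step `m`, if any. The values of the fields beyond the length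
are irrelevant. -/
structure Computation (P : Network k) where
  len : ℕ∞
  net : ℕ → Network k
  label : ℕ → Act
  contrib : ℕ → Fin k → Option Act
  net_zero : net 0 = P
  step : ∀ m : ℕ, (m : ℕ∞) < len → (net m).Step (label m) (contrib m) (net (m + 1))

namespace Computation

variable {P : Network k}

/-- `C.Extends C'`: the computation `C'` is `C` itself or a proper extension of `C`. In particular
an infinite computation has no extension but itself. -/
def Extends (C C' : Computation P) : Prop :=
  C.len ≤ C'.len ∧
  ∀ m : ℕ, (m : ℕ∞) < C.len →
    C'.label m = C.label m ∧ C'.contrib m = C.contrib m ∧ C'.net (m + 1) = C.net (m + 1)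

/-- The action `μ` is the label of some step of `C`. -/
def Contains (C : Computation P) (μ : Act) : Prop :=
  ∃ m : ℕ, (m : ℕ∞) < C.len ∧ C.label m = μ

/-- The action `μ` occurs in the projection of `C` over the component `i`. -/
def ProjContains (C : Computation P) (i : Fin k) (μ : Act) : Prop :=
  ∃ m : ℕ, (m : ℕ∞) < C.len ∧ C.contrib m i = some μ

end Computation

/-- The network is an electoral system: every computation `C` has an extension `C'` and a leader
`n` such that every component performs `out̄ n` in `C'`, and no extension of `C'` contains an action
`out̄ m` with `m ≠ n`. -/
def IsElectoral (P : Network k) : Prop :=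
  ∀ C : Computation P, ∃ C' : Computation P, C.Extends C' ∧
    ∃ n : Fin k,
      (∀ i : Fin k, C'.ProjContains i (.out .out (.num n))) ∧
      ∀ C'' : Computation P, C'.Extends C'' →
        ∀ m : ℕ, m ≠ (n : ℕ) → ¬ C''.Contains (.out .out (.num m))

end Network

/-! ### Hypergraphs, automorphisms and symmetric networks -/

/-- A hypergraph with nodes `V` and edges `X` (below, these types are finite). -/
structure Hypergraph (V X : Type) where
  type : X → Set V

/-- A hypergraph automorphism: permutations of the nodes and of the edges that preserve types. -/
structure Hypergraph.Automorphism {V X : Type} (H : Hypergraph V X) where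
  node : Equiv.Perm V
  edge : Equiv.Perm X
  map_type : ∀ x : X, H.type (edge x) = node '' H.type x

/-- The orbit of a node: its images under the iterations of the automorphism. -/
def Hypergraph.Automorphism.orbit {V X : Type} {H : Hypergraph V X} (σ : H.Automorphism) (v : V) :
    Set V :=
  {w | ∃ i : ℕ, (σ.node ^ i) v = w}

namespace Network

variable {k : ℕ}

/-- The edges of the hypergraph of a network: the free names of `P₀ | … | Pₖ₋₁`, except `out`. -/
def chans (N : Network k) : Finset Name := (parAll N.comp).fn.erase .out

/-- The hypergraph associated to a network. -/
def hypergraph (N : Network k) : Hypergraph (Fin k) N.chans where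
  type x := {i | (x : Name) ∈ (N.comp i).fn}

/-- Automorphisms of a network. -/
structure Automorphism (N : Network k) extends N.hypergraph.Automorphism where
  edge_num : ∀ (n : Fin k) (h : Name.num n ∈ N.chans),
    (edge ⟨Name.num n, h⟩ : Name) = Name.num (node n)
  edge_bound : ∀ x : N.chans, (x : Name) ∈ N.bound ↔ (edge x : Name) ∈ N.bound

namespace Automorphism

variable {N : Network k}

/-- There is exactly one orbit, which then consists of all nodes. -/
def HasSingleOrbit (σ : N.Automorphism) : Prop :=
  ∀ i : Fin k, σ.toAutomorphism.orbit i = Set.univ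

/-- The action of an automorphism on names; names that are not edges are left unchanged. -/
def onName (σ : N.Automorphism) (a : Name) : Name :=
  if h : a ∈ N.chans then (σ.edge ⟨a, h⟩ : Name) else a

end Automorphism

/-- The network is symmetric with respect to `σ`: `P_{σ(i)}` is alpha-equivalent to `σ(Pᵢ)`. -/
def IsSymmetric (N : Network k) (σ : N.Automorphism) : Prop :=
  ∀ i : Fin k, N.comp (σ.node i) = (N.comp i).mapNames σ.onName

end Network

end PiCalc

namespace PiCalc

/-! ### Renamings -/

-- The proof constructs one computation that preserves the symmetry for ever and therefore never
-- elects. The automorphism is extended to a permutation of all names of order `k` (`Rotation`). A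
-- network is `Rotation.Invariant` if passing from a component to its successor on the cycle amounts
-- to renaming by this permutation. If an invariant network has any step, then some component can
-- act, or two can communicate; all `k` rotated copies of that event are then performed one after
-- the other, and the result is invariant again (`Rotation.Invariant.hasRound`). When a component
-- announces `n` on `out`, its successor announces the image of `n` in the same round, and the image
-- differs from `n` because a cycle of length `k ≥ 2` has no fixed point. Adding rounds as long as
-- possible gives a computation that is infinite or ends in a network without steps. Either way it
-- has no proper extension, and every announcement in it is contradicted by a visible announcement
-- of another number (`Rotation.Invariant.not_isElectoral`).
--
-- The delicate event is a communication on a bound channel. In its `k` copies every component sends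
-- once and receives once, and one of the two has to come first. Separate choice ensures that the
-- other one survives: an input and an output that are both enabled never belong to the same sum, so
-- they commute (`TIn.confluent_tOut`, `TIn.confluent_tBOut`) and the final state does not depend on
-- the order. A mixed sum could lose one of them when it performs the other. Communications on
-- unbound channels are not needed, since the input involved can be performed alone as a visible
-- step; this also avoids announcements on `out` that are hidden inside a silent step.
--
-- Because of the rule `cong`, `Trans` cannot be inverted along the structure of a term. A visible
-- transition of a component is therefore only used to learn which action is enabled, a property
-- that is stable under congruence (`SCong.can_iff`, `Trans.can`). A transition for that action is
-- then rebuilt from the structural late relations `TIn`, `TOut` and `TBOut`, for which confluence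
-- is a direct induction.

@[simp] theorem Ref.weaken_free {n : ℕ} (a : Name) : (Ref.free a : Ref n).weaken = .free a := rfl

@[simp] theorem Ref.lift_weaken {n m : ℕ} (ρ : Ref n → Ref m) (x : Ref n) :
    Ref.lift ρ x.weaken = (ρ x).weaken := by
  cases x <;> simp [Ref.weaken, Ref.lift]

@[simp] theorem Ref.lift_zero {n m : ℕ} (ρ : Ref n → Ref m) :
    Ref.lift ρ (.bound 0) = .bound 0 := rfl

@[simp] theorem Ref.lift_free {n m : ℕ} (ρ : Ref n → Ref m) (a : Name) :
    Ref.lift ρ (.free a) = (ρ (.free a)).weaken := rfl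

@[simp] theorem Ref.lift_succ {n m : ℕ} (ρ : Ref n → Ref m) (i : Fin n) :
    Ref.lift ρ (.bound i.succ) = (ρ (.bound i)).weaken := by
  simp [Ref.lift]

theorem Ref.eq_zero_or_weaken {n : ℕ} (r : Ref (n + 1)) :
    r = .bound 0 ∨ ∃ x : Ref n, r = x.weaken := by
  rcases r with a | i
  · exact .inr ⟨.free a, rfl⟩
  · refine Fin.cases (.inl rfl) (fun j => .inr ⟨.bound j, rfl⟩) i

theorem Ref.weaken_injective {n : ℕ} : Function.Injective (Ref.weaken : Ref n → Ref (n + 1)) := by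
  intro x y h
  cases x <;> cases y <;> simp_all [Ref.weaken]

@[simp] theorem Ref.weaken_inj {n : ℕ} {x y : Ref n} : x.weaken = y.weaken ↔ x = y :=
  Ref.weaken_injective.eq_iff

@[simp] theorem Ref.weaken_ne_zero {n : ℕ} (x : Ref n) : x.weaken ≠ .bound 0 := by
  cases x <;> simp [Ref.weaken]

theorem Ref.funext_weaken {n : ℕ} {α : Type} {f g : Ref (n + 1) → α}
    (h0 : f (.bound 0) = g (.bound 0)) (h : ∀ x : Ref n, f x.weaken = g x.weaken) : f = g := by
  funext r
  rcases r.eq_zero_or_weaken with rfl | ⟨x, rfl⟩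
  · exact h0
  · exact h x

/-- Extension of a map on names and indices by a value for the innermost index. -/
def Ref.snoc {n m : ℕ} (ρ : Ref n → Ref m) (y : Ref m) : Ref (n + 1) → Ref m
  | .free a => ρ (.free a)
  | .bound i => Fin.cases y (fun j => ρ (.bound j)) i

@[simp] theorem Ref.snoc_weaken {n m : ℕ} (ρ : Ref n → Ref m) (y : Ref m) (x : Ref n) :
    Ref.snoc ρ y x.weaken = ρ x := by
  cases x <;> simp [Ref.weaken, Ref.snoc]

@[simp] theorem Ref.snoc_zero {n m : ℕ} (ρ : Ref n → Ref m) (y : Ref m) :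
    Ref.snoc ρ y (.bound 0) = y := rfl

/-- Exchange of the two innermost indices. -/
def Ref.exch {n : ℕ} : Ref (n + 2) → Ref (n + 2) :=
  Ref.snoc (Ref.lift Ref.weaken) (Ref.weaken (.bound 0))

@[simp] theorem Ref.exch_zero {n : ℕ} :
    Ref.exch (.bound 0 : Ref (n + 2)) = Ref.weaken (.bound 0) := rfl

@[simp] theorem Ref.exch_one {n : ℕ} :
    Ref.exch (Ref.weaken (.bound 0) : Ref (n + 2)) = .bound 0 := by simp [Ref.exch]

@[simp] theorem Ref.exch_weaken {n : ℕ} (x : Ref n) :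
    Ref.exch x.weaken.weaken = x.weaken.weaken := by simp [Ref.exch]

theorem Ref.lift_comp {n m l : ℕ} (ρ : Ref n → Ref m) (ρ' : Ref m → Ref l) :
    Ref.lift (ρ' ∘ ρ) = Ref.lift ρ' ∘ Ref.lift ρ :=
  Ref.funext_weaken (by simp) (by simp)

theorem Ref.lift_id {n : ℕ} : Ref.lift (id : Ref n → Ref n) = id :=
  Ref.funext_weaken (by simp) (by simp)

mutual
theorem Proc.rename_rename : ∀ {n m l : ℕ} (P : Proc n) (ρ : Ref n → Ref m) (ρ' : Ref m → Ref l),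
    (P.rename ρ).rename ρ' = P.rename (ρ' ∘ ρ)
  | _, _, _, .sum S, ρ, ρ' => by simp only [Proc.rename, S.rename_rename]
  | _, _, _, .nu P, ρ, ρ' => by simp only [Proc.rename, P.rename_rename, Ref.lift_comp]
  | _, _, _, .par P Q, ρ, ρ' => by simp only [Proc.rename, P.rename_rename, Q.rename_rename]
  | _, _, _, .rep P, ρ, ρ' => by simp only [Proc.rename, P.rename_rename]
theorem Choice.rename_rename : ∀ {n m l : ℕ} (S : Choice n) (ρ : Ref n → Ref m)
    (ρ' : Ref m → Ref l), (S.rename ρ).rename ρ' = S.rename (ρ' ∘ ρ)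
  | _, _, _, .nil, ρ, ρ' => by simp only [Choice.rename]
  | _, _, _, .inp x P S, ρ, ρ' => by
      simp only [Choice.rename, P.rename_rename, S.rename_rename, Ref.lift_comp,
        Function.comp_apply]
  | _, _, _, .out x y P S, ρ, ρ' => by
      simp only [Choice.rename, P.rename_rename, S.rename_rename, Function.comp_apply]
  | _, _, _, .tau P S, ρ, ρ' => by
      simp only [Choice.rename, P.rename_rename, S.rename_rename]
end

/-- Two renamings agree on `A` if they agree on the free names in `A` and on all indices. -/
def Ref.AgreeOn {n m : ℕ} (A : Finset Name) (ρ ρ' : Ref n → Ref m) : Prop :=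
  (∀ a ∈ A, ρ (.free a) = ρ' (.free a)) ∧ ∀ i, ρ (.bound i) = ρ' (.bound i)

theorem Ref.AgreeOn.mono {n m : ℕ} {A B : Finset Name} {ρ ρ' : Ref n → Ref m}
    (h : Ref.AgreeOn A ρ ρ') (hB : B ⊆ A) : Ref.AgreeOn B ρ ρ' :=
  ⟨fun a ha => h.1 a (hB ha), h.2⟩

theorem Ref.AgreeOn.lift {n m : ℕ} {A : Finset Name} {ρ ρ' : Ref n → Ref m}
    (h : Ref.AgreeOn A ρ ρ') : Ref.AgreeOn A (Ref.lift ρ) (Ref.lift ρ') := by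
  refine ⟨fun a ha => by simp [h.1 a ha], fun i => ?_⟩
  refine Fin.cases rfl (fun j => ?_) i
  simp [h.2 j]

theorem Ref.AgreeOn.apply {n m : ℕ} {A : Finset Name} {ρ ρ' : Ref n → Ref m}
    (h : Ref.AgreeOn A ρ ρ') {x : Ref n} (hx : x.fn ⊆ A) : ρ x = ρ' x := by
  cases x with
  | free a => exact h.1 a (hx (by simp [Ref.fn]))
  | bound i => exact h.2 i

mutual
theorem Proc.rename_congr : ∀ {n m : ℕ} (P : Proc n) {ρ ρ' : Ref n → Ref m},
    Ref.AgreeOn P.fn ρ ρ' → P.rename ρ = P.rename ρ'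
  | _, _, .sum S, _, _, h => by
      simp only [Proc.rename, S.rename_congr h]
  | _, _, .nu P, _, _, h => by
      simp only [Proc.rename, P.rename_congr h.lift]
  | _, _, .par P Q, _, _, h => by
      simp only [Proc.rename, P.rename_congr (h.mono (by simp [Proc.fn])),
        Q.rename_congr (h.mono (by simp [Proc.fn]))]
  | _, _, .rep P, _, _, h => by
      simp only [Proc.rename, P.rename_congr h]
theorem Choice.rename_congr : ∀ {n m : ℕ} (S : Choice n) {ρ ρ' : Ref n → Ref m},
    Ref.AgreeOn S.fn ρ ρ' → S.rename ρ = S.rename ρ'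
  | _, _, .nil, _, _, h => by simp only [Choice.rename]
  | _, _, .inp x P S, _, _, h => by
      simp only [Choice.rename, P.rename_congr (h.mono (by grind [Choice.fn])).lift,
        S.rename_congr (h.mono (by grind [Choice.fn])),
        h.apply (x := x) (by grind [Choice.fn])]
  | _, _, .out x y P S, _, _, h => by
      simp only [Choice.rename, P.rename_congr (h.mono (by grind [Choice.fn])),
        S.rename_congr (h.mono (by grind [Choice.fn])),
        h.apply (x := x) (by grind [Choice.fn]), h.apply (x := y) (by grind [Choice.fn])]
  | _, _, .tau P S, _, _, h => by
      simp only [Choice.rename, P.rename_congr (h.mono (by grind [Choice.fn])),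
        S.rename_congr (h.mono (by grind [Choice.fn]))]
end

theorem Ref.free_eq_of_mem_fn {n m : ℕ} {x : Ref n} {ρ ρ' : Ref n → Ref m} (h : ρ x = ρ' x)
    {a : Name} (ha : a ∈ x.fn) : ρ (.free a) = ρ' (.free a) := by
  cases x with
  | free b => simp only [Ref.fn, Finset.mem_singleton] at ha; exact ha ▸ h
  | bound i => simp [Ref.fn] at ha

mutual
-- Bound names are indices, so the two renamed terms can be compared occurrence by occurrence. This
-- is what forces the `k`-th iterate of the automorphism to fix every free name of the network.
theorem Proc.eq_of_rename_eq : ∀ {n m : ℕ} (P : Proc n) {ρ ρ' : Ref n → Ref m},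
    P.rename ρ = P.rename ρ' → ∀ a ∈ P.fn, ρ (.free a) = ρ' (.free a)
  | _, _, .sum S, _, _, h, a, ha => by
      simp only [Proc.rename, Proc.sum.injEq] at h
      exact S.eq_of_rename_eq h a ha
  | _, _, .nu P, _, _, h, a, ha => by
      simp only [Proc.rename, Proc.nu.injEq] at h
      simpa using P.eq_of_rename_eq h a ha
  | _, _, .par P Q, _, _, h, a, ha => by
      simp only [Proc.rename, Proc.par.injEq] at h
      simp only [Proc.fn, Finset.mem_union] at ha
      rcases ha with ha | ha
      · exact P.eq_of_rename_eq h.1 a ha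
      · exact Q.eq_of_rename_eq h.2 a ha
  | _, _, .rep P, _, _, h, a, ha => by
      simp only [Proc.rename, Proc.rep.injEq] at h
      exact P.eq_of_rename_eq h a ha
theorem Choice.eq_of_rename_eq : ∀ {n m : ℕ} (S : Choice n) {ρ ρ' : Ref n → Ref m},
    S.rename ρ = S.rename ρ' → ∀ a ∈ S.fn, ρ (.free a) = ρ' (.free a)
  | _, _, .nil, _, _, h, a, ha => by simp [Choice.fn] at ha
  | _, _, .inp x P S, _, _, h, a, ha => by
      simp only [Choice.rename, Choice.inp.injEq] at h
      simp only [Choice.fn, Finset.mem_union] at ha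
      rcases ha with (ha | ha) | ha
      · exact Ref.free_eq_of_mem_fn h.1 ha
      · simpa using P.eq_of_rename_eq h.2.1 a ha
      · exact S.eq_of_rename_eq h.2.2 a ha
  | _, _, .out x y P S, _, _, h, a, ha => by
      simp only [Choice.rename, Choice.out.injEq] at h
      simp only [Choice.fn, Finset.mem_union] at ha
      rcases ha with ((ha | ha) | ha) | ha
      · exact Ref.free_eq_of_mem_fn h.1 ha
      · exact Ref.free_eq_of_mem_fn h.2.1 ha
      · exact P.eq_of_rename_eq h.2.2.1 a ha
      · exact S.eq_of_rename_eq h.2.2.2 a ha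
  | _, _, .tau P S, _, _, h, a, ha => by
      simp only [Choice.rename, Choice.tau.injEq] at h
      simp only [Choice.fn, Finset.mem_union] at ha
      rcases ha with ha | ha
      · exact P.eq_of_rename_eq h.1 a ha
      · exact S.eq_of_rename_eq h.2 a ha
end

@[simp] theorem Ref.fn_weaken {n : ℕ} (x : Ref n) : x.weaken.fn = x.fn := by cases x <;> rfl

theorem Ref.mem_fn_iff {n : ℕ} {x : Ref n} {a : Name} : a ∈ x.fn ↔ x = .free a := by
  cases x <;> simp [Ref.fn, eq_comm]

/-- The image of a set of names under a renaming is contained in `B`, and so are all the names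
substituted for indices. -/
def Ref.MapsInto {n m : ℕ} (ρ : Ref n → Ref m) (A B : Finset Name) : Prop :=
  (∀ a ∈ A, (ρ (.free a)).fn ⊆ B) ∧ ∀ i, (ρ (.bound i)).fn ⊆ B

theorem Ref.MapsInto.mono {n m : ℕ} {ρ : Ref n → Ref m} {A A' B : Finset Name}
    (h : Ref.MapsInto ρ A B) (hA : A' ⊆ A) : Ref.MapsInto ρ A' B :=
  ⟨fun a ha => h.1 a (hA ha), h.2⟩

theorem Ref.MapsInto.lift {n m : ℕ} {ρ : Ref n → Ref m} {A B : Finset Name}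
    (h : Ref.MapsInto ρ A B) : Ref.MapsInto (Ref.lift ρ) A B := by
  refine ⟨fun a ha => by simpa using h.1 a ha, fun i => ?_⟩
  refine Fin.cases (by simp [Ref.fn]) (fun j => ?_) i
  simpa using h.2 j

theorem Ref.MapsInto.apply {n m : ℕ} {ρ : Ref n → Ref m} {A B : Finset Name}
    (h : Ref.MapsInto ρ A B) {x : Ref n} (hx : x.fn ⊆ A) : (ρ x).fn ⊆ B := by
  cases x with
  | free a => exact h.1 a (hx (by simp [Ref.fn]))
  | bound i => exact h.2 i

mutual
theorem Proc.fn_rename_subset : ∀ {n m : ℕ} (P : Proc n) {ρ : Ref n → Ref m} {B : Finset Name},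
    Ref.MapsInto ρ P.fn B → (P.rename ρ).fn ⊆ B
  | _, _, .sum S, _, _, h => S.fn_rename_subset h
  | _, _, .nu P, _, _, h => P.fn_rename_subset h.lift
  | _, _, .par P Q, _, _, h =>
      Finset.union_subset (P.fn_rename_subset (h.mono (by grind [Proc.fn])))
        (Q.fn_rename_subset (h.mono (by grind [Proc.fn])))
  | _, _, .rep P, _, _, h => P.fn_rename_subset h
theorem Choice.fn_rename_subset : ∀ {n m : ℕ} (S : Choice n) {ρ : Ref n → Ref m}
    {B : Finset Name}, Ref.MapsInto ρ S.fn B → (S.rename ρ).fn ⊆ B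
  | _, _, .nil, _, _, _ => by simp [Choice.rename, Choice.fn]
  | _, _, .inp x P S, _, _, h =>
      Finset.union_subset (Finset.union_subset (h.apply (x := x) (by grind [Choice.fn]))
        (P.fn_rename_subset (h.mono (by grind [Choice.fn])).lift))
        (S.fn_rename_subset (h.mono (by grind [Choice.fn])))
  | _, _, .out x y P S, _, _, h =>
      Finset.union_subset (Finset.union_subset (Finset.union_subset
        (h.apply (x := x) (by grind [Choice.fn])) (h.apply (x := y) (by grind [Choice.fn])))
        (P.fn_rename_subset (h.mono (by grind [Choice.fn]))))
        (S.fn_rename_subset (h.mono (by grind [Choice.fn])))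
  | _, _, .tau P S, _, _, h =>
      Finset.union_subset (P.fn_rename_subset (h.mono (by grind [Choice.fn])))
        (S.fn_rename_subset (h.mono (by grind [Choice.fn])))
end

theorem Ref.fn_subset_of_mem {n m : ℕ} (ρ : Ref n → Ref m) {x : Ref n} {a : Name}
    (ha : a ∈ x.fn) : (ρ (.free a)).fn ⊆ (ρ x).fn := by
  rw [Ref.mem_fn_iff] at ha; rw [ha]

mutual
theorem Proc.subset_fn_rename : ∀ {n m : ℕ} (P : Proc n) (ρ : Ref n → Ref m) {a : Name},
    a ∈ P.fn → (ρ (.free a)).fn ⊆ (P.rename ρ).fn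
  | _, _, .sum S, ρ, _, h => S.subset_fn_rename ρ h
  | _, _, .nu P, ρ, _, h => by
      have := P.subset_fn_rename (Ref.lift ρ) h
      rwa [Ref.lift_free, Ref.fn_weaken] at this
  | _, _, .par P Q, ρ, _, h => by
      simp only [Proc.fn, Finset.mem_union] at h
      simp only [Proc.rename, Proc.fn]
      rcases h with h | h
      · exact (P.subset_fn_rename ρ h).trans Finset.subset_union_left
      · exact (Q.subset_fn_rename ρ h).trans Finset.subset_union_right
  | _, _, .rep P, ρ, _, h => P.subset_fn_rename ρ h
theorem Choice.subset_fn_rename : ∀ {n m : ℕ} (S : Choice n) (ρ : Ref n → Ref m) {a : Name},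
    a ∈ S.fn → (ρ (.free a)).fn ⊆ (S.rename ρ).fn
  | _, _, .nil, _, _, h => by simp [Choice.fn] at h
  | _, _, .inp x P S, ρ, a, h => by
      simp only [Choice.fn, Finset.mem_union] at h
      simp only [Choice.rename, Choice.fn]
      rcases h with (h | h) | h
      · have := Ref.fn_subset_of_mem ρ h
        grind
      · have := P.subset_fn_rename (Ref.lift ρ) h
        simp only [Ref.lift_free, Ref.fn_weaken] at this
        grind
      · have := S.subset_fn_rename ρ h
        grind
  | _, _, .out x y P S, ρ, a, h => by
      simp only [Choice.fn, Finset.mem_union] at h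
      simp only [Choice.rename, Choice.fn]
      rcases h with ((h | h) | h) | h
      · have := Ref.fn_subset_of_mem ρ h
        grind
      · have := Ref.fn_subset_of_mem ρ h
        grind
      · have := P.subset_fn_rename ρ h
        grind
      · have := S.subset_fn_rename ρ h
        grind
  | _, _, .tau P S, ρ, a, h => by
      simp only [Choice.fn, Finset.mem_union] at h
      simp only [Choice.rename, Choice.fn]
      rcases h with h | h
      · have := P.subset_fn_rename ρ h
        grind
      · have := S.subset_fn_rename ρ h
        grind
end

theorem Proc.fn_rename_eq {n m : ℕ} (P : Proc n) {ρ : Ref n → Ref m}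
    (hf : ∀ a, ρ (.free a) = .free a) (hb : ∀ i, (ρ (.bound i)).fn = ∅) :
    (P.rename ρ).fn = P.fn := by
  refine (P.fn_rename_subset ⟨fun a ha => ?_, fun i => ?_⟩).antisymm fun a ha => ?_
  · simpa [hf, Ref.fn] using ha
  · simp [hb]
  · exact P.subset_fn_rename ρ ha (by simp [hf, Ref.fn])

@[simp] theorem Proc.fn_weaken {n : ℕ} (P : Proc n) : P.weaken.fn = P.fn :=
  P.fn_rename_eq (fun _ => rfl) fun _ => rfl

@[simp] theorem Proc.fn_rename_exch {n : ℕ} (P : Proc (n + 2)) : (P.rename Ref.exch).fn = P.fn := by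
  refine P.fn_rename_eq (fun _ => rfl) fun i => ?_
  refine Fin.cases rfl (fun i => Fin.cases rfl (fun j => ?_) i) i
  exact congrArg Ref.fn (Ref.exch_weaken (.bound j))

mutual
@[simp] theorem Proc.rename_id : ∀ {n : ℕ} (P : Proc n), P.rename id = P
  | _, .sum S => by simp only [Proc.rename, S.rename_id]
  | _, .nu P => by simp only [Proc.rename, Ref.lift_id, P.rename_id]
  | _, .par P Q => by simp only [Proc.rename, P.rename_id, Q.rename_id]
  | _, .rep P => by simp only [Proc.rename, P.rename_id]
theorem Choice.rename_id : ∀ {n : ℕ} (S : Choice n), S.rename id = S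
  | _, .nil => by simp only [Choice.rename]
  | _, .inp x P S => by simp only [Choice.rename, Ref.lift_id, P.rename_id, S.rename_id, id]
  | _, .out x y P S => by simp only [Choice.rename, P.rename_id, S.rename_id, id]
  | _, .tau P S => by simp only [Choice.rename, P.rename_id, S.rename_id]
end

theorem Proc.rename_weaken_lift {n m : ℕ} (P : Proc n) (ρ : Ref n → Ref m) :
    P.weaken.rename (Ref.lift ρ) = (P.rename ρ).weaken := by
  simp only [Proc.weaken, Proc.rename_rename]
  congr 1; funext x; simp

theorem Proc.weaken_rename_snoc {n m : ℕ} (P : Proc n) (ρ : Ref n → Ref m) (y : Ref m) :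
    P.weaken.rename (Ref.snoc ρ y) = P.rename ρ := by
  simp only [Proc.weaken, Proc.rename_rename]
  congr 1; funext x; simp

/-! ### Instantiation, restriction and renaming of names -/

theorem Ref.eq_free (r : Ref 0) : ∃ a, r = .free a := by
  rcases r with a | i
  · exact ⟨a, rfl⟩
  · exact i.elim0

theorem Proc.inst_eq (y : Name) (P : Proc 1) :
    P.inst y = P.rename (Ref.snoc id (.free y)) := by
  unfold Proc.inst
  congr 1; funext r
  rcases r with a | i
  · rfl
  · obtain rfl : i = 0 := Subsingleton.elim _ _
    rfl

/-- The renaming that turns a free name into the innermost index. -/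
def Ref.closeName (y : Name) : Ref 0 → Ref 1
  | .free a => if a = y then .bound 0 else .free a
  | .bound i => i.elim0

theorem Proc.close_eq (y : Name) (P : Proc 0) : P.close y = P.rename (Ref.closeName y) := by
  unfold Proc.close
  congr 1

theorem Ref.closeName_of_ne {y a : Name} (h : a ≠ y) :
    Ref.closeName y (.free a) = (Ref.free a).weaken := by simp [Ref.closeName, h]

theorem Ref.closeName_self (y : Name) : Ref.closeName y (.free y) = .bound 0 := by
  simp [Ref.closeName]

theorem Proc.close_inst {y : Name} {X : Proc 1} (h : y ∉ X.fn) : (X.inst y).close y = X := by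
  rw [Proc.close_eq, Proc.inst_eq, Proc.rename_rename]
  conv_rhs => rw [← X.rename_id]
  refine X.rename_congr ⟨fun a ha => ?_, fun i => ?_⟩
  · have : a ≠ y := fun e => h (e ▸ ha)
    exact Ref.closeName_of_ne this
  · obtain rfl : i = 0 := Subsingleton.elim _ _
    exact Ref.closeName_self y

theorem Proc.res_inst {y : Name} {X : Proc 1} (h : y ∉ X.fn) : Proc.res y (X.inst y) = .nu X := by
  rw [Proc.res, Proc.close_inst h]

theorem Proc.rename_lift_inst {n : ℕ} (P : Proc (n + 1)) (ρ : Ref n → Ref 0) (y : Name) :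
    (P.rename (Ref.lift ρ)).inst y = P.rename (Ref.snoc ρ (.free y)) := by
  rw [Proc.inst_eq, Proc.rename_rename]
  congr 1
  exact Ref.funext_weaken (by simp) (by simp)

/-- The transition rules only know restrictions of a named variable; this presents an anonymous
binder as the restriction of any sufficiently fresh name. -/
theorem Proc.rename_nu_eq_res {n : ℕ} {P : Proc (n + 1)} {ρ : Ref n → Ref 0} {y : Name}
    (h : y ∉ ((Proc.nu P).rename ρ).fn) :
    (Proc.nu P).rename ρ = Proc.res y (P.rename (Ref.snoc ρ (.free y))) := by
  rw [← Proc.rename_lift_inst, Proc.res_inst h, Proc.rename]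

theorem Proc.close_of_notMem {y : Name} {P : Proc 0} (h : y ∉ P.fn) : P.close y = P.weaken := by
  rw [Proc.close_eq, Proc.weaken]
  refine P.rename_congr ⟨fun a ha => ?_, fun i => i.elim0⟩
  exact Ref.closeName_of_ne fun e => h (e ▸ ha)

theorem Proc.fn_inst_subset (y : Name) (P : Proc 1) : (P.inst y).fn ⊆ insert y P.fn := by
  rw [Proc.inst_eq]
  refine P.fn_rename_subset ⟨fun a ha => ?_, fun i => ?_⟩
  · simpa [Ref.snoc, Ref.fn] using .inr ha
  · obtain rfl : i = 0 := Subsingleton.elim _ _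
    simp [Ref.fn]

/-- The renaming of references induced by a map of names. -/
def Ref.mapName {n : ℕ} (f : Name → Name) : Ref n → Ref n
  | .free a => .free (f a)
  | .bound i => .bound i

theorem Proc.mapNames_eq {n : ℕ} (f : Name → Name) (P : Proc n) :
    P.mapNames f = P.rename (Ref.mapName f) := by
  unfold Proc.mapNames
  congr 1

@[simp] theorem Ref.mapName_weaken {n : ℕ} (f : Name → Name) (x : Ref n) :
    Ref.mapName f x.weaken = (Ref.mapName f x).weaken := by cases x <;> rfl

@[simp] theorem Ref.mapName_zero {n : ℕ} (f : Name → Name) :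
    Ref.mapName f (.bound 0 : Ref (n + 1)) = .bound 0 := rfl

@[simp] theorem Ref.lift_mapName {n : ℕ} (f : Name → Name) :
    Ref.lift (Ref.mapName f : Ref n → Ref n) = Ref.mapName f :=
  Ref.funext_weaken (by simp) (by simp)

theorem Proc.mapNames_mapNames {n : ℕ} (f g : Name → Name) (P : Proc n) :
    (P.mapNames f).mapNames g = P.mapNames (g ∘ f) := by
  simp only [Proc.mapNames_eq, Proc.rename_rename]
  congr 1; funext r; cases r <;> rfl

@[simp] theorem Proc.mapNames_id {n : ℕ} (P : Proc n) : P.mapNames id = P := by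
  rw [Proc.mapNames_eq]
  conv_rhs => rw [← P.rename_id]
  congr 1; funext r; cases r <;> rfl

theorem Proc.mapNames_congr {n : ℕ} {f g : Name → Name} {P : Proc n}
    (h : ∀ a ∈ P.fn, f a = g a) : P.mapNames f = P.mapNames g := by
  simp only [Proc.mapNames_eq]
  exact P.rename_congr ⟨fun a ha => by simp [Ref.mapName, h a ha], fun _ => rfl⟩

theorem Proc.eq_of_mapNames_eq {n : ℕ} {f g : Name → Name} {P : Proc n}
    (h : P.mapNames f = P.mapNames g) {a : Name} (ha : a ∈ P.fn) : f a = g a := by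
  simp only [Proc.mapNames_eq] at h
  simpa [Ref.mapName] using P.eq_of_rename_eq h a ha

@[simp] theorem Proc.fn_mapNames {n : ℕ} (f : Name → Name) (P : Proc n) :
    (P.mapNames f).fn = P.fn.image f := by
  rw [Proc.mapNames_eq]
  refine (P.fn_rename_subset ⟨fun a ha => ?_, fun i => ?_⟩).antisymm fun a ha => ?_
  · simpa [Ref.mapName, Ref.fn] using ⟨a, ha, rfl⟩
  · simp [Ref.mapName, Ref.fn]
  · obtain ⟨b, hb, rfl⟩ := Finset.mem_image.1 ha
    exact P.subset_fn_rename _ hb (by simp [Ref.mapName, Ref.fn])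

theorem Proc.mapNames_inst (f : Name → Name) (y : Name) (P : Proc 1) :
    (P.inst y).mapNames f = (P.mapNames f).inst (f y) := by
  simp only [Proc.mapNames_eq, Proc.inst_eq, Proc.rename_rename]
  congr 1
  exact Ref.funext_weaken (by simp [Ref.mapName]) (by simp)

theorem Proc.mapNames_res {f : Name → Name} (hf : f.Injective) (y : Name) (P : Proc 0) :
    (P.res y).mapNames f = (P.mapNames f).res (f y) := by
  simp only [Proc.mapNames_eq, Proc.res, Proc.close_eq, Proc.rename, Proc.rename_rename,
    Ref.lift_mapName]
  congr 2; funext r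
  obtain ⟨a, rfl⟩ := r.eq_free
  by_cases h : a = y
  · subst h; simp [Ref.closeName, Ref.mapName]
  · simp [Ref.closeName, Ref.mapName, h, hf.ne h]

/-! ### Structural congruence: renaming, free names, separateness -/

mutual
theorem SCong.rename : ∀ {n m : ℕ} {P Q : Proc n} (ρ : Ref n → Ref m), SCong P Q →
    SCong (P.rename ρ) (Q.rename ρ)
  | _, _, _, _, _, .refl _ => .refl _
  | _, _, _, _, ρ, .symm h => .symm (SCong.rename ρ h)
  | _, _, _, _, ρ, .trans h h' => .trans (SCong.rename ρ h) (SCong.rename ρ h')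
  | _, _, _, _, ρ, .scope P Q => by
      simp only [Proc.rename, Proc.rename_weaken_lift]
      exact .scope _ _
  | _, _, _, _, ρ, .sum h => by
      simp only [Proc.rename]
      exact .sum (SCongChoice.rename ρ h)
  | _, _, _, _, ρ, .nu h => by
      simp only [Proc.rename]
      exact .nu (SCong.rename _ h)
  | _, _, _, _, ρ, .par h h' => by
      simp only [Proc.rename]
      exact .par (SCong.rename _ h) (SCong.rename _ h')
  | _, _, _, _, ρ, .rep h => by
      simp only [Proc.rename]
      exact .rep (SCong.rename _ h)
theorem SCongChoice.rename : ∀ {n m : ℕ} {S T : Choice n} (ρ : Ref n → Ref m), SCongChoice S T →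
    SCongChoice (S.rename ρ) (T.rename ρ)
  | _, _, _, _, _, .nil => by simp only [Choice.rename]; exact .nil
  | _, _, _, _, ρ, .inp x h h' => by
      simp only [Choice.rename]
      exact .inp _ (SCong.rename _ h) (SCongChoice.rename _ h')
  | _, _, _, _, ρ, .out x y h h' => by
      simp only [Choice.rename]
      exact .out _ _ (SCong.rename _ h) (SCongChoice.rename _ h')
  | _, _, _, _, ρ, .tau h h' => by
      simp only [Choice.rename]
      exact .tau (SCong.rename _ h) (SCongChoice.rename _ h')
end

/-- Renaming of a summand. -/
def Branch.rename {n m : ℕ} (ρ : Ref n → Ref m) : Branch n → Branch m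
  | .inp x P => .inp (ρ x) (P.rename (Ref.lift ρ))
  | .out x y P => .out (ρ x) (ρ y) (P.rename ρ)
  | .tau P => .tau (P.rename ρ)

theorem Choice.branches_rename : ∀ {n m : ℕ} (S : Choice n) (ρ : Ref n → Ref m),
    (S.rename ρ).branches = S.branches.map (Branch.rename ρ)
  | _, _, .nil, _ => by simp only [Choice.rename, Choice.branches, List.map_nil]
  | _, _, .inp x P S, ρ => by
      simp only [Choice.rename, Choice.branches, List.map_cons, S.branches_rename, Branch.rename]
  | _, _, .out x y P S, ρ => by
      simp only [Choice.rename, Choice.branches, List.map_cons, S.branches_rename, Branch.rename]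
  | _, _, .tau P S, ρ => by
      simp only [Choice.rename, Choice.branches, List.map_cons, S.branches_rename, Branch.rename]

@[simp] theorem Branch.isOut_rename {n m : ℕ} (ρ : Ref n → Ref m) (b : Branch n) :
    (b.rename ρ).IsOut ↔ b.IsOut := by cases b <;> rfl

@[simp] theorem Branch.isInp_rename {n m : ℕ} (ρ : Ref n → Ref m) (b : Branch n) :
    (b.rename ρ).IsInp ↔ b.IsInp := by cases b <;> rfl

mutual
@[simp] theorem Proc.isSeparate_rename : ∀ {n m : ℕ} (P : Proc n) (ρ : Ref n → Ref m),
    (P.rename ρ).IsSeparate ↔ P.IsSeparate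
  | _, _, .sum S, ρ => by
      simp [Proc.rename, Proc.IsSeparate, Choice.branches_rename, S.isSeparate_rename]
  | _, _, .nu P, ρ => by simp [Proc.rename, Proc.IsSeparate, P.isSeparate_rename]
  | _, _, .par P Q, ρ => by
      simp [Proc.rename, Proc.IsSeparate, P.isSeparate_rename, Q.isSeparate_rename]
  | _, _, .rep P, ρ => by simp [Proc.rename, Proc.IsSeparate, P.isSeparate_rename]
theorem Choice.isSeparate_rename : ∀ {n m : ℕ} (S : Choice n) (ρ : Ref n → Ref m),
    (S.rename ρ).IsSeparate ↔ S.IsSeparate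
  | _, _, .nil, ρ => by simp [Choice.rename, Choice.IsSeparate]
  | _, _, .inp x P S, ρ => by
      simp [Choice.rename, Choice.IsSeparate, P.isSeparate_rename, S.isSeparate_rename]
  | _, _, .out x y P S, ρ => by
      simp [Choice.rename, Choice.IsSeparate, P.isSeparate_rename, S.isSeparate_rename]
  | _, _, .tau P S, ρ => by
      simp [Choice.rename, Choice.IsSeparate, P.isSeparate_rename, S.isSeparate_rename]
end

@[simp] theorem Proc.isSeparate_weaken {n : ℕ} (P : Proc n) : P.weaken.IsSeparate ↔ P.IsSeparate :=
  P.isSeparate_rename _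

@[simp] theorem Proc.isSeparate_inst (y : Name) (P : Proc 1) :
    (P.inst y).IsSeparate ↔ P.IsSeparate := P.isSeparate_rename _

@[simp] theorem Proc.isSeparate_res (y : Name) (P : Proc 0) :
    (P.res y).IsSeparate ↔ P.IsSeparate := P.isSeparate_rename _

mutual
theorem SCong.isSeparate_iff : ∀ {n : ℕ} {P Q : Proc n}, SCong P Q →
    (P.IsSeparate ↔ Q.IsSeparate)
  | _, _, _, .refl _ => .rfl
  | _, _, _, .symm h => (SCong.isSeparate_iff h).symm
  | _, _, _, .trans h h' => (SCong.isSeparate_iff h).trans (SCong.isSeparate_iff h')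
  | _, _, _, .scope P Q => by simp [Proc.IsSeparate]
  | _, _, _, .sum h => by
      have := SCongChoice.isSeparate_iff h
      simp only [Proc.IsSeparate, this]
  | _, _, _, .nu h => by simpa [Proc.IsSeparate] using SCong.isSeparate_iff h
  | _, _, _, .par h h' => by
      simp [Proc.IsSeparate, SCong.isSeparate_iff h, SCong.isSeparate_iff h']
  | _, _, _, .rep h => by simpa [Proc.IsSeparate] using SCong.isSeparate_iff h
theorem SCongChoice.isSeparate_iff : ∀ {n : ℕ} {S T : Choice n}, SCongChoice S T →
    ((∀ b ∈ S.branches, ¬ b.IsOut) ↔ (∀ b ∈ T.branches, ¬ b.IsOut)) ∧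
    ((∀ b ∈ S.branches, ¬ b.IsInp) ↔ (∀ b ∈ T.branches, ¬ b.IsInp)) ∧
    (S.IsSeparate ↔ T.IsSeparate)
  | _, _, _, .nil => by simp
  | _, _, _, .inp x h h' => by
      have := SCongChoice.isSeparate_iff h'
      have := SCong.isSeparate_iff h
      simp_all [Choice.IsSeparate, Choice.branches, Branch.IsInp, Branch.IsOut]
  | _, _, _, .out x y h h' => by
      have := SCongChoice.isSeparate_iff h'
      have := SCong.isSeparate_iff h
      simp_all [Choice.IsSeparate, Choice.branches, Branch.IsInp, Branch.IsOut]
  | _, _, _, .tau h h' => by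
      have := SCongChoice.isSeparate_iff h'
      have := SCong.isSeparate_iff h
      simp_all [Choice.IsSeparate, Choice.branches, Branch.IsInp, Branch.IsOut]
end

theorem Choice.isSeparate_of_mem_branches : ∀ {n : ℕ} {S : Choice n}, S.IsSeparate →
    ∀ b ∈ S.branches, match b with
      | .inp _ P => P.IsSeparate
      | .out _ _ P => P.IsSeparate
      | .tau P => P.IsSeparate
  | _, .nil, _ => by simp [Choice.branches]
  | _, .inp x P S, h => by
      simp only [Choice.IsSeparate] at h
      simp only [Choice.branches, List.mem_cons, forall_eq_or_imp]
      exact ⟨h.1, isSeparate_of_mem_branches h.2⟩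
  | _, .out x y P S, h => by
      simp only [Choice.IsSeparate] at h
      simp only [Choice.branches, List.mem_cons, forall_eq_or_imp]
      exact ⟨h.1, isSeparate_of_mem_branches h.2⟩
  | _, .tau P S, h => by
      simp only [Choice.IsSeparate] at h
      simp only [Choice.branches, List.mem_cons, forall_eq_or_imp]
      exact ⟨h.1, isSeparate_of_mem_branches h.2⟩

theorem Trans.isSeparate {P Q : Proc 0} {μ : Act} (h : Trans P μ Q) (hP : P.IsSeparate) :
    Q.IsSeparate := by
  induction h with
  | inp y h => simpa using Choice.isSeparate_of_mem_branches hP.2 _ h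
  | out h => exact Choice.isSeparate_of_mem_branches hP.2 _ h
  | tau h => exact Choice.isSeparate_of_mem_branches hP.2 _ h
  | opn _ _ ih => exact ih (by simpa using hP)
  | res _ _ ih => simpa using ih (by simpa using hP)
  | parL _ _ ih => exact ⟨ih hP.1, hP.2⟩
  | parR _ _ ih => exact ⟨hP.1, ih hP.2⟩
  | comL _ _ ih ih' => exact ⟨ih hP.1, ih' hP.2⟩
  | comR _ _ ih ih' => exact ⟨ih hP.1, ih' hP.2⟩
  | closeL _ _ _ ih ih' => exact (Proc.isSeparate_res _ _).2 ⟨ih hP.1, ih' hP.2⟩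
  | closeR _ _ _ ih ih' => exact (Proc.isSeparate_res _ _).2 ⟨ih hP.1, ih' hP.2⟩
  | rep _ ih => exact ih ⟨hP, hP⟩
  | cong h _ h' ih => exact h'.isSeparate_iff.1 (ih (h.isSeparate_iff.1 hP))

theorem SCong.mapNames {n : ℕ} {P Q : Proc n} (f : Name → Name) (h : SCong P Q) :
    SCong (P.mapNames f) (Q.mapNames f) := h.rename _

/-- The action of a map of names on actions. -/
def Act.map (f : Name → Name) : Act → Act
  | .inp x y => .inp (f x) (f y)
  | .out x y => .out (f x) (f y)
  | .bout x y => .bout (f x) (f y)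
  | .tau => .tau

@[simp] theorem Act.bn_map (f : Name → Name) (μ : Act) : (μ.map f).bn = μ.bn.image f := by
  cases μ <;> simp [Act.map, Act.bn]

@[simp] theorem Act.names_map (f : Name → Name) (μ : Act) :
    (μ.map f).names = μ.names.image f := by
  cases μ <;> simp [Act.map, Act.names, Finset.image_insert]

/-- Injectivity keeps the side conditions of the rules, which all say that names are distinct or
fresh. In this way a transition of one component is transported to its successor under a rotation.
-/
theorem Trans.mapNames {f : Name → Name} (hf : f.Injective) {P Q : Proc 0} {μ : Act}
    (h : Trans P μ Q) : Trans (P.mapNames f) (μ.map f) (Q.mapNames f) := by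
  have hd : ∀ {A B : Finset Name}, Disjoint A B → Disjoint (A.image f) (B.image f) :=
    fun h => (Finset.disjoint_image hf).2 h
  have hm : ∀ {A : Finset Name} {y : Name}, y ∉ A → f y ∉ A.image f := by
    intro A y h h'
    obtain ⟨z, hz, e⟩ := Finset.mem_image.1 h'
    exact h (hf e ▸ hz)
  have hpar : ∀ P Q : Proc 0, (Proc.par P Q).mapNames f = .par (P.mapNames f) (Q.mapNames f) :=
    fun _ _ => by simp only [Proc.mapNames_eq, Proc.rename]
  have hsum : ∀ S : Choice 0, (Proc.sum S).mapNames f = .sum (S.rename (Ref.mapName f)) :=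
    fun _ => by simp only [Proc.mapNames_eq, Proc.rename]
  induction h with
  | inp y h =>
    rw [hsum, Proc.mapNames_inst]
    refine .inp _ ?_
    rw [Choice.branches_rename, List.mem_map]
    exact ⟨_, h, by simp [Branch.rename, Ref.mapName, Proc.mapNames_eq]⟩
  | out h =>
    rw [hsum]
    refine .out ?_
    rw [Choice.branches_rename, List.mem_map]
    exact ⟨_, h, by simp [Branch.rename, Ref.mapName, Proc.mapNames_eq]⟩
  | tau h =>
    rw [hsum]
    refine .tau ?_
    rw [Choice.branches_rename, List.mem_map]
    exact ⟨_, h, by simp [Branch.rename, Proc.mapNames_eq]⟩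
  | opn _ h ih => rw [Proc.mapNames_res hf]; exact .opn ih (hf.ne h)
  | res _ h ih =>
    rw [Proc.mapNames_res hf, Proc.mapNames_res hf]
    exact .res ih (by simpa using hm h)
  | parL _ h ih => rw [hpar, hpar]; exact .parL ih (by simpa using hd h)
  | parR _ h ih => rw [hpar, hpar]; exact .parR ih (by simpa using hd h)
  | comL _ _ ih ih' => rw [hpar, hpar]; exact .comL ih ih'
  | comR _ _ ih ih' => rw [hpar, hpar]; exact .comR ih ih'
  | closeL _ _ h ih ih' =>
    rw [hpar, Proc.mapNames_res hf, hpar]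
    exact .closeL ih ih' (by rw [Proc.fn_mapNames]; exact hm h)
  | closeR _ _ h ih ih' =>
    rw [hpar, Proc.mapNames_res hf, hpar]
    exact .closeR ih ih' (by rw [Proc.fn_mapNames]; exact hm h)
  | rep _ ih =>
    rw [hpar] at ih
    have : ∀ P : Proc 0, (Proc.rep P).mapNames f = .rep (P.mapNames f) := fun _ => by
      simp only [Proc.mapNames_eq, Proc.rename]
    rw [this] at ih ⊢
    exact .rep ih
  | cong h _ h' ih => exact .cong (h.mapNames f) ih (h'.mapNames f)

/-! ### Actions enabled in a term -/

/-- An input on `x` is enabled. -/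
def Proc.CanIn : {n : ℕ} → Proc n → Ref n → Prop
  | _, .sum S, x => ∃ P, Branch.inp x P ∈ S.branches
  | _, .nu P, x => P.CanIn x.weaken
  | _, .par P Q, x => P.CanIn x ∨ Q.CanIn x
  | _, .rep P, x => P.CanIn x

/-- A free output of `y` on `x` is enabled. -/
def Proc.CanOut : {n : ℕ} → Proc n → Ref n → Ref n → Prop
  | _, .sum S, x, y => ∃ P, Branch.out x y P ∈ S.branches
  | _, .nu P, x, y => P.CanOut x.weaken y.weaken
  | _, .par P Q, x, y => P.CanOut x y ∨ Q.CanOut x y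
  | _, .rep P, x, y => P.CanOut x y

/-- A bound output on `x` is enabled. -/
def Proc.CanBOut : {n : ℕ} → Proc n → Ref n → Prop
  | _, .sum _, _ => False
  | _, .nu P, x => P.CanOut x.weaken (.bound 0) ∨ P.CanBOut x.weaken
  | _, .par P Q, x => P.CanBOut x ∨ Q.CanBOut x
  | _, .rep P, x => P.CanBOut x

theorem Ref.lift_eq_weaken {n m : ℕ} {ρ : Ref n → Ref m} {r : Ref (n + 1)} {x : Ref m} :
    Ref.lift ρ r = x.weaken ↔ ∃ r', r = r'.weaken ∧ ρ r' = x := by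
  rcases r.eq_zero_or_weaken with rfl | ⟨r, rfl⟩
  · simp only [Ref.lift_zero]
    constructor
    · intro h; exact absurd h.symm (Ref.weaken_ne_zero x)
    · rintro ⟨r', h, _⟩; exact absurd h.symm (Ref.weaken_ne_zero r')
  · simp

theorem Ref.lift_eq_zero {n m : ℕ} {ρ : Ref n → Ref m} {r : Ref (n + 1)} :
    Ref.lift ρ r = .bound 0 ↔ r = .bound 0 := by
  rcases r.eq_zero_or_weaken with rfl | ⟨r, rfl⟩ <;> simp

theorem Branch.inp_mem_map_rename {n m : ℕ} {ρ : Ref n → Ref m} {l : List (Branch n)} {x : Ref m} :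
    (∃ P, Branch.inp x P ∈ l.map (Branch.rename ρ)) ↔ ∃ y, ρ y = x ∧ ∃ P, Branch.inp y P ∈ l := by
  constructor
  · rintro ⟨P, h⟩
    obtain ⟨b, hb, e⟩ := List.mem_map.1 h
    cases b with
    | inp y P =>
      simp only [Branch.rename, Branch.inp.injEq] at e
      exact ⟨y, e.1, P, hb⟩
    | out => simp [Branch.rename] at e
    | tau => simp [Branch.rename] at e
  · rintro ⟨y, rfl, P, h⟩
    exact ⟨_, List.mem_map.2 ⟨_, h, rfl⟩⟩

theorem Branch.out_mem_map_rename {n m : ℕ} {ρ : Ref n → Ref m} {l : List (Branch n)}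
    {x y : Ref m} : (∃ P, Branch.out x y P ∈ l.map (Branch.rename ρ)) ↔
      ∃ x' y', ρ x' = x ∧ ρ y' = y ∧ ∃ P, Branch.out x' y' P ∈ l := by
  constructor
  · rintro ⟨P, h⟩
    obtain ⟨b, hb, e⟩ := List.mem_map.1 h
    cases b with
    | inp => simp [Branch.rename] at e
    | out x' y' P =>
      simp only [Branch.rename, Branch.out.injEq] at e
      exact ⟨x', y', e.1, e.2.1, P, hb⟩
    | tau => simp [Branch.rename] at e
  · rintro ⟨x', y', rfl, rfl, P, h⟩
    exact ⟨_, List.mem_map.2 ⟨_, h, rfl⟩⟩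

theorem Proc.canIn_rename : ∀ {n m : ℕ} (P : Proc n) {ρ : Ref n → Ref m} {x : Ref m},
    (P.rename ρ).CanIn x ↔ ∃ x', ρ x' = x ∧ P.CanIn x'
  | _, _, .sum S, ρ, x => by
      simp only [Proc.rename, Proc.CanIn, Choice.branches_rename, Branch.inp_mem_map_rename]
  | _, _, .nu P, ρ, x => by
      simp only [Proc.rename, Proc.CanIn, P.canIn_rename, Ref.lift_eq_weaken]
      grind
  | _, _, .par P Q, ρ, x => by
      simp only [Proc.rename, Proc.CanIn, P.canIn_rename, Q.canIn_rename]
      grind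
  | _, _, .rep P, ρ, x => by
      simp only [Proc.rename, Proc.CanIn, P.canIn_rename]

theorem Proc.canOut_rename : ∀ {n m : ℕ} (P : Proc n) {ρ : Ref n → Ref m} {x y : Ref m},
    (P.rename ρ).CanOut x y ↔ ∃ x' y', ρ x' = x ∧ ρ y' = y ∧ P.CanOut x' y'
  | _, _, .sum S, ρ, x, y => by
      simp only [Proc.rename, Proc.CanOut, Choice.branches_rename, Branch.out_mem_map_rename]
  | _, _, .nu P, ρ, x, y => by
      simp only [Proc.rename, Proc.CanOut, P.canOut_rename, Ref.lift_eq_weaken]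
      grind
  | _, _, .par P Q, ρ, x, y => by
      simp only [Proc.rename, Proc.CanOut, P.canOut_rename, Q.canOut_rename]
      grind
  | _, _, .rep P, ρ, x, y => by
      simp only [Proc.rename, Proc.CanOut, P.canOut_rename]

theorem Proc.canBOut_rename : ∀ {n m : ℕ} (P : Proc n) {ρ : Ref n → Ref m} {x : Ref m},
    (P.rename ρ).CanBOut x ↔ ∃ x', ρ x' = x ∧ P.CanBOut x'
  | _, _, .sum S, ρ, x => by simp [Proc.rename, Proc.CanBOut]
  | _, _, .nu P, ρ, x => by
      simp only [Proc.rename, Proc.CanBOut, P.canBOut_rename, P.canOut_rename, Ref.lift_eq_weaken,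
        Ref.lift_eq_zero]
      grind
  | _, _, .par P Q, ρ, x => by
      simp only [Proc.rename, Proc.CanBOut, P.canBOut_rename, Q.canBOut_rename]
      grind
  | _, _, .rep P, ρ, x => by
      simp only [Proc.rename, Proc.CanBOut, P.canBOut_rename]

@[simp] theorem Proc.canIn_weaken {n : ℕ} {P : Proc n} {x : Ref n} :
    P.weaken.CanIn x.weaken ↔ P.CanIn x := by
  simp [Proc.weaken, Proc.canIn_rename]

@[simp] theorem Proc.canOut_weaken {n : ℕ} {P : Proc n} {x y : Ref n} :
    P.weaken.CanOut x.weaken y.weaken ↔ P.CanOut x y := by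
  simp [Proc.weaken, Proc.canOut_rename]

@[simp] theorem Proc.not_canOut_weaken {n : ℕ} {P : Proc n} {x : Ref (n + 1)} :
    ¬ P.weaken.CanOut x (.bound 0) := by
  simp [Proc.weaken, Proc.canOut_rename]

@[simp] theorem Proc.canBOut_weaken {n : ℕ} {P : Proc n} {x : Ref n} :
    P.weaken.CanBOut x.weaken ↔ P.CanBOut x := by
  simp [Proc.weaken, Proc.canBOut_rename]

mutual
-- The critical case is scope expansion: a weakened term can do exactly what it could before, and it
-- can never output the new index, so no bound output is created.
theorem SCong.can_iff : ∀ {n : ℕ} {P Q : Proc n}, SCong P Q →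
    (∀ x, P.CanIn x ↔ Q.CanIn x) ∧ (∀ x y, P.CanOut x y ↔ Q.CanOut x y) ∧
      (∀ x, P.CanBOut x ↔ Q.CanBOut x)
  | _, _, _, .refl _ => by simp
  | _, _, _, .symm h => by simp [SCong.can_iff h]
  | _, _, _, .trans h h' => by simp [SCong.can_iff h, SCong.can_iff h']
  | _, _, _, .scope P Q => by simp [Proc.CanIn, Proc.CanOut, Proc.CanBOut, or_assoc]
  | _, _, _, .sum h => by simp [Proc.CanIn, Proc.CanOut, Proc.CanBOut, SCongChoice.can_iff h]
  | _, _, _, .nu h => by simp [Proc.CanIn, Proc.CanOut, Proc.CanBOut, SCong.can_iff h]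
  | _, _, _, .par h h' => by
      simp [Proc.CanIn, Proc.CanOut, Proc.CanBOut, SCong.can_iff h, SCong.can_iff h']
  | _, _, _, .rep h => by simp [Proc.CanIn, Proc.CanOut, Proc.CanBOut, SCong.can_iff h]
theorem SCongChoice.can_iff : ∀ {n : ℕ} {S T : Choice n}, SCongChoice S T →
    (∀ x, (∃ P, Branch.inp x P ∈ S.branches) ↔ ∃ P, Branch.inp x P ∈ T.branches) ∧
    (∀ x y, (∃ P, Branch.out x y P ∈ S.branches) ↔ ∃ P, Branch.out x y P ∈ T.branches)
  | _, _, _, .nil => by simp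
  | _, _, _, .inp x h h' => by
      have := SCongChoice.can_iff h'
      simp [Choice.branches, exists_or, this]
  | _, _, _, .out x y h h' => by
      have := SCongChoice.can_iff h'
      simp [Choice.branches, exists_or, this]
  | _, _, _, .tau h h' => by
      have := SCongChoice.can_iff h'
      simp [Choice.branches, this]
end

/-- The visible action `μ` is enabled (up to the choice of the name that is received or
extruded). -/
def Proc.Can (P : Proc 0) : Act → Prop
  | .inp x _ => P.CanIn (.free x)
  | .out x y => P.CanOut (.free x) (.free y)
  | .bout x _ => P.CanBOut (.free x)
  | .tau => True

/-- The target of the transition is given up on purpose: enabledness is what remains accessible in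
the presence of `cong`. -/
theorem Trans.can {P Q : Proc 0} {μ : Act} (h : Trans P μ Q) : P.Can μ := by
  have hc : ∀ (y : Name) {x : Name}, y ≠ x → Ref.closeName y (.free x) = (Ref.free x).weaken :=
    fun y x h => Ref.closeName_of_ne h.symm
  induction h with
  | inp y h => exact ⟨_, h⟩
  | out h => exact ⟨_, h⟩
  | tau h => trivial
  | @opn P P' x y _ h ih =>
    refine .inl ?_
    rw [Proc.close_eq]
    exact Proc.canOut_rename _ |>.2 ⟨_, _, hc _ h.symm, Ref.closeName_self _, ih⟩
  | @res P P' μ y _ h ih =>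
    cases μ with
    | inp x z =>
      simp only [Act.names, Finset.mem_insert, Finset.mem_singleton, not_or] at h
      rw [Proc.res, Proc.close_eq]
      exact Proc.canIn_rename _ |>.2 ⟨_, hc _ h.1, ih⟩
    | out x z =>
      simp only [Act.names, Finset.mem_insert, Finset.mem_singleton, not_or] at h
      rw [Proc.res, Proc.close_eq]
      exact Proc.canOut_rename _ |>.2 ⟨_, _, hc _ h.1, hc _ h.2, ih⟩
    | bout x z =>
      simp only [Act.names, Finset.mem_insert, Finset.mem_singleton, not_or] at h
      rw [Proc.res, Proc.close_eq]
      exact .inr (Proc.canBOut_rename _ |>.2 ⟨_, hc _ h.1, ih⟩)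
    | tau => trivial
  | @parL _ _ _ μ _ _ ih => cases μ <;> first | trivial | exact .inl ih
  | @parR _ _ _ μ _ _ ih => cases μ <;> first | trivial | exact .inr ih
  | comL => trivial
  | comR => trivial
  | closeL => trivial
  | closeR => trivial
  -- Enabledness in `P | !P` is a disjunction whose two sides both unfold to enabledness in `P`.
  | @rep P P' μ _ ih =>
    cases μ with
    | tau => trivial
    | inp => exact ih.elim id id
    | out => exact ih.elim id id
    | bout => exact ih.elim id id
  | @cong _ _ _ _ μ h _ _ ih =>
    have := h.can_iff
    cases μ with
    | tau => trivial
    | inp => exact (this.1 _).2 ih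
    | out => exact (this.2.1 _ _).2 ih
    | bout => exact (this.2.2 _).2 ih

/-! ### Late visible transitions of terms with indices -/

/-- Late input transitions; the innermost index of the target stands for the received name. -/
inductive TIn : {n : ℕ} → Proc n → Ref n → Proc (n + 1) → Prop
  | sum {n : ℕ} {S : Choice n} {x : Ref n} {P : Proc (n + 1)} :
      Branch.inp x P ∈ S.branches → TIn (.sum S) x P
  | nu {n : ℕ} {P : Proc (n + 1)} {x : Ref n} {A : Proc (n + 2)} :
      TIn P x.weaken A → TIn (.nu P) x (.nu (A.rename Ref.exch))
  | parL {n : ℕ} {P Q : Proc n} {x : Ref n} {A : Proc (n + 1)} :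
      TIn P x A → TIn (.par P Q) x (.par A Q.weaken)
  | parR {n : ℕ} {P Q : Proc n} {x : Ref n} {A : Proc (n + 1)} :
      TIn Q x A → TIn (.par P Q) x (.par P.weaken A)
  | rep {n : ℕ} {P : Proc n} {x : Ref n} {A : Proc (n + 1)} :
      TIn P x A → TIn (.rep P) x (.par A (Proc.rep P).weaken)

/-- Free output transitions. -/
inductive TOut : {n : ℕ} → Proc n → Ref n → Ref n → Proc n → Prop
  | sum {n : ℕ} {S : Choice n} {x y : Ref n} {P : Proc n} :
      Branch.out x y P ∈ S.branches → TOut (.sum S) x y P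
  | nu {n : ℕ} {P : Proc (n + 1)} {x y : Ref n} {A : Proc (n + 1)} :
      TOut P x.weaken y.weaken A → TOut (.nu P) x y (.nu A)
  | parL {n : ℕ} {P Q : Proc n} {x y : Ref n} {A : Proc n} :
      TOut P x y A → TOut (.par P Q) x y (.par A Q)
  | parR {n : ℕ} {P Q : Proc n} {x y : Ref n} {A : Proc n} :
      TOut Q x y A → TOut (.par P Q) x y (.par P A)
  | rep {n : ℕ} {P : Proc n} {x y : Ref n} {A : Proc n} :
      TOut P x y A → TOut (.rep P) x y (.par A (.rep P))

/-- Bound output transitions; the innermost index of the target stands for the extruded name. -/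
inductive TBOut : {n : ℕ} → Proc n → Ref n → Proc (n + 1) → Prop
  | opn {n : ℕ} {P : Proc (n + 1)} {x : Ref n} {A : Proc (n + 1)} :
      TOut P x.weaken (.bound 0) A → TBOut (.nu P) x A
  | nu {n : ℕ} {P : Proc (n + 1)} {x : Ref n} {A : Proc (n + 2)} :
      TBOut P x.weaken A → TBOut (.nu P) x (.nu (A.rename Ref.exch))
  | parL {n : ℕ} {P Q : Proc n} {x : Ref n} {A : Proc (n + 1)} :
      TBOut P x A → TBOut (.par P Q) x (.par A Q.weaken)
  | parR {n : ℕ} {P Q : Proc n} {x : Ref n} {A : Proc (n + 1)} :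
      TBOut Q x A → TBOut (.par P Q) x (.par P.weaken A)
  | rep {n : ℕ} {P : Proc n} {x : Ref n} {A : Proc (n + 1)} :
      TBOut P x A → TBOut (.rep P) x (.par A (Proc.rep P).weaken)

theorem Proc.CanIn.exists_tIn : ∀ {n : ℕ} {P : Proc n} {x : Ref n}, P.CanIn x →
    ∃ A, TIn P x A
  | _, .sum S, x, h => by
      obtain ⟨P, h⟩ : ∃ P, Branch.inp x P ∈ S.branches := h
      exact ⟨P, .sum h⟩
  | _, .nu P, x, h => (CanIn.exists_tIn (P := P) h).elim fun _ h => ⟨_, .nu h⟩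
  | _, .par P Q, x, h => by
      rcases (h : P.CanIn x ∨ Q.CanIn x) with h | h
      · exact h.exists_tIn.elim fun _ h => ⟨_, .parL h⟩
      · exact h.exists_tIn.elim fun _ h => ⟨_, .parR h⟩
  | _, .rep P, x, h =>
      (CanIn.exists_tIn (P := P) h).elim fun _ h => ⟨_, .rep h⟩

theorem Proc.CanOut.exists_tOut : ∀ {n : ℕ} {P : Proc n} {x y : Ref n}, P.CanOut x y →
    ∃ A, TOut P x y A
  | _, .sum S, x, y, h => by
      obtain ⟨P, h⟩ : ∃ P, Branch.out x y P ∈ S.branches := h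
      exact ⟨P, .sum h⟩
  | _, .nu P, x, y, h => (CanOut.exists_tOut (P := P) h).elim fun _ h => ⟨_, .nu h⟩
  | _, .par P Q, x, y, h => by
      rcases (h : P.CanOut x y ∨ Q.CanOut x y) with h | h
      · exact h.exists_tOut.elim fun _ h => ⟨_, .parL h⟩
      · exact h.exists_tOut.elim fun _ h => ⟨_, .parR h⟩
  | _, .rep P, x, y, h =>
      (CanOut.exists_tOut (P := P) h).elim fun _ h => ⟨_, .rep h⟩

theorem Proc.CanBOut.exists_tBOut : ∀ {n : ℕ} {P : Proc n} {x : Ref n}, P.CanBOut x →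
    ∃ A, TBOut P x A
  | _, .sum S, x, h => h.elim
  | _, .nu P, x, h => by
      rcases (h : P.CanOut x.weaken (.bound 0) ∨ P.CanBOut x.weaken) with h | h
      · exact h.exists_tOut.elim fun _ h => ⟨_, .opn h⟩
      · exact h.exists_tBOut.elim fun _ h => ⟨_, .nu h⟩
  | _, .par P Q, x, h => by
      rcases (h : P.CanBOut x ∨ Q.CanBOut x) with h | h
      · exact h.exists_tBOut.elim fun _ h => ⟨_, .parL h⟩
      · exact h.exists_tBOut.elim fun _ h => ⟨_, .parR h⟩
  | _, .rep P, x, h =>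
      (CanBOut.exists_tBOut (P := P) h).elim fun _ h => ⟨_, .rep h⟩

theorem Proc.rename_exch_lift_lift {n m : ℕ} (A : Proc (n + 2)) (ρ : Ref n → Ref m) :
    (A.rename Ref.exch).rename (Ref.lift (Ref.lift ρ)) =
      (A.rename (Ref.lift (Ref.lift ρ))).rename Ref.exch := by
  simp only [Proc.rename_rename]
  congr 1
  exact Ref.funext_weaken (by simp) fun x => by
    rcases x.eq_zero_or_weaken with rfl | ⟨x, rfl⟩ <;> simp

theorem TIn.rename {n : ℕ} {P : Proc n} {x : Ref n} {A : Proc (n + 1)} (h : TIn P x A) {m : ℕ}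
    (ρ : Ref n → Ref m) : TIn (P.rename ρ) (ρ x) (A.rename (Ref.lift ρ)) := by
  induction h generalizing m with
  | sum h =>
    simp only [Proc.rename]
    refine .sum ?_
    rw [Choice.branches_rename]
    exact List.mem_map.2 ⟨_, h, rfl⟩
  | nu _ ih =>
    simp only [Proc.rename, Proc.rename_exch_lift_lift]
    have := ih (Ref.lift ρ)
    rw [Ref.lift_weaken] at this
    exact .nu this
  | parL _ ih =>
    simp only [Proc.rename, Proc.rename_weaken_lift]
    exact .parL (ih ρ)
  | parR _ ih =>
    simp only [Proc.rename, Proc.rename_weaken_lift]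
    exact .parR (ih ρ)
  | rep _ ih =>
    simp only [Proc.rename, Proc.rename_weaken_lift]
    exact .rep (ih ρ)

theorem TOut.rename {n : ℕ} {P : Proc n} {x y : Ref n} {A : Proc n} (h : TOut P x y A) {m : ℕ}
    (ρ : Ref n → Ref m) : TOut (P.rename ρ) (ρ x) (ρ y) (A.rename ρ) := by
  induction h generalizing m with
  | sum h =>
    simp only [Proc.rename]
    refine .sum ?_
    rw [Choice.branches_rename]
    exact List.mem_map.2 ⟨_, h, rfl⟩
  | nu _ ih =>
    simp only [Proc.rename]
    have := ih (Ref.lift ρ)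
    rw [Ref.lift_weaken, Ref.lift_weaken] at this
    exact .nu this
  | parL _ ih => simp only [Proc.rename]; exact .parL (ih ρ)
  | parR _ ih => simp only [Proc.rename]; exact .parR (ih ρ)
  | rep _ ih => simp only [Proc.rename]; exact .rep (ih ρ)

theorem TBOut.rename {n : ℕ} {P : Proc n} {x : Ref n} {A : Proc (n + 1)} (h : TBOut P x A) {m : ℕ}
    (ρ : Ref n → Ref m) : TBOut (P.rename ρ) (ρ x) (A.rename (Ref.lift ρ)) := by
  induction h generalizing m with
  | opn h =>
    simp only [Proc.rename]
    have := h.rename (Ref.lift ρ)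
    rw [Ref.lift_weaken, Ref.lift_zero] at this
    exact .opn this
  | nu _ ih =>
    simp only [Proc.rename, Proc.rename_exch_lift_lift]
    have := ih (Ref.lift ρ)
    rw [Ref.lift_weaken] at this
    exact .nu this
  | parL _ ih =>
    simp only [Proc.rename, Proc.rename_weaken_lift]
    exact .parL (ih ρ)
  | parR _ ih =>
    simp only [Proc.rename, Proc.rename_weaken_lift]
    exact .parR (ih ρ)
  | rep _ ih =>
    simp only [Proc.rename, Proc.rename_weaken_lift]
    exact .rep (ih ρ)

theorem Choice.fn_subset_of_mem_branches : ∀ {n : ℕ} {S : Choice n},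
    ∀ b ∈ S.branches, match b with
      | .inp _ P => P.fn ⊆ S.fn
      | .out _ _ P => P.fn ⊆ S.fn
      | .tau P => P.fn ⊆ S.fn
  | _, .nil => by simp [Choice.branches]
  | _, .inp x P S => by
      simp only [Choice.branches, List.mem_cons, forall_eq_or_imp, Choice.fn]
      refine ⟨by grind, fun b hb => ?_⟩
      have := Choice.fn_subset_of_mem_branches b hb
      cases b <;> grind
  | _, .out x y P S => by
      simp only [Choice.branches, List.mem_cons, forall_eq_or_imp, Choice.fn]
      refine ⟨by grind, fun b hb => ?_⟩
      have := Choice.fn_subset_of_mem_branches b hb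
      cases b <;> grind
  | _, .tau P S => by
      simp only [Choice.branches, List.mem_cons, forall_eq_or_imp, Choice.fn]
      refine ⟨by grind, fun b hb => ?_⟩
      have := Choice.fn_subset_of_mem_branches b hb
      cases b <;> grind

theorem TIn.fn_subset {n : ℕ} {P : Proc n} {x : Ref n} {A : Proc (n + 1)} (h : TIn P x A) :
    A.fn ⊆ P.fn := by
  induction h with
  | sum h => exact Choice.fn_subset_of_mem_branches _ h
  | nu _ ih => simpa [Proc.fn] using ih
  | parL _ ih => simp only [Proc.fn, Proc.fn_weaken]; grind
  | parR _ ih => simp only [Proc.fn, Proc.fn_weaken]; grind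
  | rep _ ih => simp only [Proc.fn, Proc.fn_weaken]; grind

theorem TOut.fn_subset {n : ℕ} {P : Proc n} {x y : Ref n} {A : Proc n} (h : TOut P x y A) :
    A.fn ⊆ P.fn := by
  induction h with
  | sum h => exact Choice.fn_subset_of_mem_branches _ h
  | nu _ ih => simpa [Proc.fn] using ih
  | parL _ ih => simp only [Proc.fn]; grind
  | parR _ ih => simp only [Proc.fn]; grind
  | rep _ ih => simp only [Proc.fn]; grind

theorem TBOut.fn_subset {n : ℕ} {P : Proc n} {x : Ref n} {A : Proc (n + 1)} (h : TBOut P x A) :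
    A.fn ⊆ P.fn := by
  induction h with
  | opn h => exact h.fn_subset
  | nu _ ih => simpa [Proc.fn] using ih
  | parL _ ih => simp only [Proc.fn, Proc.fn_weaken]; grind
  | parR _ ih => simp only [Proc.fn, Proc.fn_weaken]; grind
  | rep _ ih => simp only [Proc.fn, Proc.fn_weaken]; grind

-- Commutation of inputs with outputs under separate choice

/-- Input and free output of a separate-choice term commute. -/
theorem TIn.confluent_tOut {n : ℕ} {P : Proc n} {x : Ref n} {A : Proc (n + 1)} (h : TIn P x A)
    {y z : Ref n} {B : Proc n} (h' : TOut P y z B) (hP : P.IsSeparate) :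
    ∃ S, TIn B x S ∧ TOut A y.weaken z.weaken S := by
  induction h with
  | sum h =>
    cases h' with
    -- The decisive use of separate choice: one sum would contain both an input and an output
    -- summand.
    | sum h' =>
      rcases hP.1 with hP | hP
      · exact absurd trivial (hP _ h')
      · exact absurd trivial (hP _ h)
  | nu _ ih =>
    cases h' with
    | nu h' =>
      obtain ⟨S, h1, h2⟩ := ih h' hP
      refine ⟨_, .nu h1, .nu ?_⟩
      simpa using h2.rename Ref.exch
  | parL h ih =>
    cases h' with
    | parL h' =>
      obtain ⟨S, h1, h2⟩ := ih h' hP.1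
      exact ⟨_, .parL h1, .parL h2⟩
    | parR h' => exact ⟨_, .parL h, .parR (h'.rename _)⟩
  | parR h ih =>
    cases h' with
    | parL h' => exact ⟨_, .parR h, .parL (h'.rename _)⟩
    | parR h' =>
      obtain ⟨S, h1, h2⟩ := ih h' hP.2
      exact ⟨_, .parR h1, .parR h2⟩
  -- The late rule for replication unfolds a single copy, from which both actions are taken. The
  -- square for that copy therefore closes with the same replicated term beside it.
  | rep h ih =>
    cases h' with
    | rep h' =>
      obtain ⟨S, h1, h2⟩ := ih h' hP
      exact ⟨_, .parL h1, .parL h2⟩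

theorem Proc.weaken_weaken_exch {n : ℕ} (P : Proc n) :
    P.weaken.weaken.rename Ref.exch = P.weaken.weaken := by
  simp only [Proc.weaken, Proc.rename_rename]
  congr 1; funext x; simp

theorem Proc.rename_lift_weaken_exch {n : ℕ} (P : Proc (n + 1)) :
    (P.rename (Ref.lift Ref.weaken)).rename Ref.exch = P.weaken := by
  simp only [Proc.weaken, Proc.rename_rename]
  congr 1; exact Ref.funext_weaken (by simp) (by simp)

theorem Proc.weaken_exch {n : ℕ} (P : Proc (n + 1)) :
    P.weaken.rename Ref.exch = P.rename (Ref.lift Ref.weaken) := by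
  simp only [Proc.weaken, Proc.rename_rename]
  congr 1; exact Ref.funext_weaken (by simp) (by simp)

/-- Input and bound output of a separate-choice term commute. -/
theorem TIn.confluent_tBOut {n : ℕ} {P : Proc n} {x : Ref n} {A : Proc (n + 1)} (h : TIn P x A)
    {y : Ref n} {B : Proc (n + 1)} (h' : TBOut P y B) (hP : P.IsSeparate) :
    ∃ S, TIn B x.weaken S ∧ TBOut A y.weaken (S.rename Ref.exch) := by
  -- In `S` the innermost index is the received name and the next one the extruded name. When the
  -- input comes first they are bound in the opposite order, whence `Ref.exch`.
  induction h with
  | sum h => cases h'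
  | nu h ih =>
    cases h' with
    -- Opening only removes the binder, so the square is the one for a free output of the innermost
    -- index.
    | opn h' =>
      obtain ⟨S, h1, h2⟩ := h.confluent_tOut h' hP
      refine ⟨_, h1, .opn ?_⟩
      simpa using h2.rename Ref.exch
    | nu h' =>
      obtain ⟨S, h1, h2⟩ := ih h' hP
      refine ⟨_, .nu (by simpa using h1.rename Ref.exch), ?_⟩
      have := TBOut.nu (by simpa using h2.rename Ref.exch)
      refine Eq.subst (motive := TBOut _ _) ?_ this
      simp only [Proc.rename, Proc.rename_rename]
      congr 2
      refine Ref.funext_weaken (by simp) fun x => ?_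
      rcases x.eq_zero_or_weaken with rfl | ⟨x, rfl⟩
      · simp
      · rcases x.eq_zero_or_weaken with rfl | ⟨x, rfl⟩ <;> simp
  | parL h ih =>
    cases h' with
    | parL h' =>
      obtain ⟨S, h1, h2⟩ := ih h' hP.1
      refine ⟨_, .parL h1, ?_⟩
      simp only [Proc.rename, Proc.weaken_weaken_exch]
      exact .parL h2
    | parR h' =>
      refine ⟨_, .parL (h.rename _), ?_⟩
      simp only [Proc.rename, Proc.weaken_exch, Proc.rename_lift_weaken_exch]
      exact .parR (h'.rename _)
  | parR h ih =>
    cases h' with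
    | parL h' =>
      refine ⟨_, .parR (h.rename _), ?_⟩
      simp only [Proc.rename, Proc.weaken_exch, Proc.rename_lift_weaken_exch]
      exact .parL (h'.rename _)
    | parR h' =>
      obtain ⟨S, h1, h2⟩ := ih h' hP.2
      refine ⟨_, .parR h1, ?_⟩
      simp only [Proc.rename, Proc.weaken_weaken_exch]
      exact .parR h2
  | rep h ih =>
    cases h' with
    | rep h' =>
      obtain ⟨S, h1, h2⟩ := ih h' hP
      refine ⟨_, .parL h1, ?_⟩
      simp only [Proc.rename, Proc.weaken_weaken_exch]
      exact .parL h2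

/-! ### From late to early transitions -/

theorem Name.exists_notMem (F : Finset Name) : ∃ y : Name, y ∉ F :=
  have : Infinite Name := Infinite.of_injective Name.var fun _ _ h => by simpa using h
  Infinite.exists_notMem_finset F

theorem Proc.fn_rename_snoc_subset {n : ℕ} (P : Proc (n + 1)) (ρ : Ref n → Ref 0) (y : Name) :
    (P.rename (Ref.snoc ρ (.free y))).fn ⊆ insert y ((Proc.nu P).rename ρ).fn := by
  rw [← Proc.rename_lift_inst]
  exact Proc.fn_inst_subset _ _

theorem Proc.rename_exch_snoc_snoc {n : ℕ} (A : Proc (n + 2)) (ρ : Ref n → Ref 0) (y w : Name) :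
    (A.rename Ref.exch).rename (Ref.snoc (Ref.snoc ρ (.free w)) (.free y)) =
      A.rename (Ref.snoc (Ref.snoc ρ (.free y)) (.free w)) := by
  simp only [Proc.rename_rename]
  congr 1
  exact Ref.funext_weaken (by simp) fun x => by
    rcases x.eq_zero_or_weaken with rfl | ⟨x, rfl⟩ <;> simp

/-- Early transitions exist for closed terms only, whereas the induction passes under binders. The
statement is therefore made for every substitution of names for the indices; at a binder a fresh
name is substituted and then restricted. -/
theorem TIn.trans_rename {n : ℕ} {P : Proc n} {x : Ref n} {A : Proc (n + 1)} (h : TIn P x A)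
    {ρ : Ref n → Ref 0} {a : Name} (ha : ρ x = .free a) (w : Name) :
    Trans (P.rename ρ) (.inp a w) (A.rename (Ref.snoc ρ (.free w))) := by
  induction h with
  | @sum n S x P h =>
    rw [← Proc.rename_lift_inst]
    simp only [Proc.rename]
    refine .inp _ ?_
    rw [Choice.branches_rename, ← ha]
    exact List.mem_map.2 ⟨_, h, rfl⟩
  | @nu n P x A _ ih =>
    obtain ⟨y, hy⟩ := Name.exists_notMem (((Proc.nu P).rename ρ).fn ∪
      ((Proc.nu (A.rename Ref.exch)).rename (Ref.snoc ρ (.free w))).fn ∪ {a, w})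
    simp only [Finset.mem_union, not_or] at hy
    rw [Proc.rename_nu_eq_res hy.1.1, Proc.rename_nu_eq_res hy.1.2, Proc.rename_exch_snoc_snoc]
    exact .res (ih (by simpa using ha)) hy.2
  | @parL n P Q x A h ih =>
    simp only [Proc.rename, Proc.weaken_rename_snoc]
    exact .parL (ih ha) (by simp [Act.bn])
  | parR h ih =>
    simp only [Proc.rename, Proc.weaken_rename_snoc]
    exact .parR (ih ha) (by simp [Act.bn])
  | rep h ih =>
    simp only [Proc.rename, Proc.weaken_rename_snoc]
    exact .rep (.parL (ih ha) (by simp [Act.bn]))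

theorem TOut.trans_rename {n : ℕ} {P : Proc n} {x y : Ref n} {A : Proc n} (h : TOut P x y A)
    {ρ : Ref n → Ref 0} {a b : Name} (ha : ρ x = .free a) (hb : ρ y = .free b) :
    Trans (P.rename ρ) (.out a b) (A.rename ρ) := by
  induction h with
  | @sum n S x y P h =>
    simp only [Proc.rename]
    refine .out ?_
    rw [Choice.branches_rename, ← ha, ← hb]
    exact List.mem_map.2 ⟨_, h, rfl⟩
  | @nu n P x y A _ ih =>
    obtain ⟨z, hz⟩ := Name.exists_notMem (((Proc.nu P).rename ρ).fn ∪
      ((Proc.nu A).rename ρ).fn ∪ {a, b})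
    simp only [Finset.mem_union, not_or] at hz
    rw [Proc.rename_nu_eq_res hz.1.1, Proc.rename_nu_eq_res hz.1.2]
    exact .res (ih (by simpa using ha) (by simpa using hb)) hz.2
  | parL h ih => exact .parL (ih ha hb) (by simp [Act.bn])
  | parR h ih => exact .parR (ih ha hb) (by simp [Act.bn])
  | rep h ih => exact .rep (.parL (ih ha hb) (by simp [Act.bn]))

theorem TBOut.trans_rename {n : ℕ} {P : Proc n} {x : Ref n} {A : Proc (n + 1)} (h : TBOut P x A)
    {ρ : Ref n → Ref 0} {a w : Name} (ha : ρ x = .free a) (hw : w ∉ (P.rename ρ).fn)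
    (hwa : w ≠ a) : Trans (P.rename ρ) (.bout a w) (A.rename (Ref.snoc ρ (.free w))) := by
  induction h with
  | @opn n P x A h =>
    rw [Proc.rename_nu_eq_res hw]
    exact .opn (h.trans_rename (by simpa using ha) (by simp)) hwa.symm
  | @nu n P x A _ ih =>
    obtain ⟨y, hy⟩ := Name.exists_notMem (((Proc.nu P).rename ρ).fn ∪
      ((Proc.nu (A.rename Ref.exch)).rename (Ref.snoc ρ (.free w))).fn ∪ {a, w})
    simp only [Finset.mem_union, not_or] at hy
    rw [Proc.rename_nu_eq_res hy.1.1, Proc.rename_nu_eq_res hy.1.2, Proc.rename_exch_snoc_snoc]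
    refine .res (ih (by simpa using ha) fun h => ?_) hy.2
    have := Proc.fn_rename_snoc_subset _ _ _ h
    grind
  | parL h ih =>
    simp only [Proc.rename, Proc.fn, Finset.mem_union, not_or] at hw
    simp only [Proc.rename, Proc.weaken_rename_snoc]
    exact .parL (ih ha hw.1) (by simpa [Act.bn] using hw.2)
  | parR h ih =>
    simp only [Proc.rename, Proc.fn, Finset.mem_union, not_or] at hw
    simp only [Proc.rename, Proc.weaken_rename_snoc]
    exact .parR (ih ha hw.2) (by simpa [Act.bn] using hw.1)
  | rep h ih =>
    simp only [Proc.rename, Proc.weaken_rename_snoc]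
    exact .rep (.parL (ih ha hw) (by simpa [Act.bn, Proc.rename] using hw))

theorem TIn.trans {P : Proc 0} {x : Name} {A : Proc 1} (h : TIn P (.free x) A) (w : Name) :
    Trans P (.inp x w) (A.inst w) := by
  have := h.trans_rename (ρ := id) rfl w
  rwa [Proc.rename_id, ← Proc.inst_eq] at this

theorem TOut.trans {P : Proc 0} {x y : Name} {A : Proc 0} (h : TOut P (.free x) (.free y) A) :
    Trans P (.out x y) A := by
  have := h.trans_rename (ρ := id) rfl rfl
  rwa [Proc.rename_id, Proc.rename_id] at this

theorem TBOut.trans {P : Proc 0} {x w : Name} {A : Proc 1} (h : TBOut P (.free x) A)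
    (hw : w ∉ P.fn) (hwx : w ≠ x) : Trans P (.bout x w) (A.inst w) := by
  have := h.trans_rename (ρ := id) rfl (by rwa [Proc.rename_id]) hwx
  rwa [Proc.rename_id, ← Proc.inst_eq] at this

/-- An input and a free output enabled in a separate-choice process close up to a square. -/
theorem exists_square_out {P : Proc 0} (hP : P.IsSeparate) {x y z : Name}
    (hi : P.CanIn (.free x)) (ho : P.CanOut (.free y) (.free z)) (w : Name) :
    ∃ Q R S, Trans P (.out y z) Q ∧ Trans P (.inp x w) R ∧ Trans Q (.inp x w) S ∧
      Trans R (.out y z) S := by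
  obtain ⟨A, hA⟩ := hi.exists_tIn
  obtain ⟨B, hB⟩ := ho.exists_tOut
  obtain ⟨S, h1, h2⟩ := hA.confluent_tOut hB hP
  refine ⟨B, A.inst w, S.inst w, hB.trans, hA.trans w, h1.trans w, ?_⟩
  rw [Proc.inst_eq, Proc.inst_eq]
  exact h2.trans_rename rfl rfl

/-- An input and a bound output enabled in a separate-choice process close up to a square. -/
theorem exists_square_bout {P : Proc 0} (hP : P.IsSeparate) {x y : Name}
    (hi : P.CanIn (.free x)) (ho : P.CanBOut (.free y)) {w z : Name} (hz : z ∉ P.fn)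
    (hzy : z ≠ y) (hzw : z ≠ w) :
    ∃ Q R S, Trans P (.bout y z) Q ∧ Trans P (.inp x w) R ∧ Trans Q (.inp x w) S ∧
      Trans R (.bout y z) S ∧ Q.fn ⊆ insert z P.fn ∧ R.fn ⊆ insert w P.fn ∧
      S.fn ⊆ insert w (insert z P.fn) := by
  obtain ⟨A, hA⟩ := hi.exists_tIn
  obtain ⟨B, hB⟩ := ho.exists_tBOut
  obtain ⟨S, h1, h2⟩ := hA.confluent_tBOut hB hP
  -- The bounds on free names also appear in the conclusion: they show later that a name not yet
  -- extruded stays fresh during a round.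
  have hR : (A.inst w).fn ⊆ insert w P.fn :=
    (Proc.fn_inst_subset _ _).trans (Finset.insert_subset_insert _ hA.fn_subset)
  have hQ : (B.inst z).fn ⊆ insert z P.fn :=
    (Proc.fn_inst_subset _ _).trans (Finset.insert_subset_insert _ hB.fn_subset)
  have h3 := h1.trans_rename (ρ := Ref.snoc id (.free z)) (a := x) rfl w
  have h4 := h2.trans_rename (ρ := Ref.snoc id (.free w)) (a := y) (w := z) rfl
    (by rw [← Proc.inst_eq]; exact fun h => by have := hR h; grind) hzy
  rw [Proc.rename_exch_snoc_snoc] at h4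
  rw [← Proc.inst_eq] at h3 h4
  refine ⟨B.inst z, A.inst w, _, hB.trans hz hzy, hA.trans w, h3, h4, hQ, hR, ?_⟩
  refine (Proc.fn_rename_snoc_subset _ _ _).trans (Finset.insert_subset_insert _ ?_)
  refine ((Proc.nu S).fn_rename_subset (B := insert z P.fn) ⟨fun a ha => ?_, fun i => ?_⟩)
  · have := hB.fn_subset (h1.fn_subset ha)
    simp [Ref.snoc, Ref.fn, this]
  · obtain rfl : i = 0 := Subsingleton.elim _ _
    simp [Ref.fn]

/-! ### Transitions of parallel compositions -/

theorem mem_fn_parAll : ∀ {k : ℕ} {P : Fin k → Proc 0} {a : Name},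
    a ∈ (parAll P).fn ↔ ∃ i, a ∈ (P i).fn
  | 0, P, a => by simp [parAll, Proc.zero, Proc.fn, Choice.fn]
  | 1, P, a => by simp [parAll]
  | k + 2, P, a => by
      simp only [parAll, Proc.fn, Finset.mem_union, mem_fn_parAll, Fin.exists_fin_succ' (n := k + 1)]
      rfl

/-- The contribution of a single active component. -/
def single {k : ℕ} (i : Fin k) (μ : Act) : Fin k → Option Act :=
  Function.update (fun _ => none) i (some μ)

/-- The contribution of two active components. -/
def double {k : ℕ} (i : Fin k) (μ : Act) (j : Fin k) (ν : Act) : Fin k → Option Act :=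
  Function.update (single i μ) j (some ν)

theorem single_eq_some {k : ℕ} {i l : Fin k} {μ ν : Act} (h : single i μ l = some ν) :
    l = i ∧ ν = μ := by
  by_cases hl : l = i
  · subst hl; simp [single] at h; exact ⟨rfl, h.symm⟩
  · simp [single, hl] at h

theorem double_eq_some {k : ℕ} {i j l : Fin k} {μ μ' ν : Act} (h : double i μ j μ' l = some ν) :
    ν = μ ∨ ν = μ' := by
  by_cases hl : l = j
  · subst hl; simp [double] at h; exact .inr h.symm
  · simp only [double, Function.update_of_ne hl] at h
    exact .inl (single_eq_some h).2

theorem double_comm {k : ℕ} {i j : Fin k} (h : i ≠ j) (μ ν : Act) :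
    double i μ j ν = double j ν i μ := by
  simp only [double, single]
  exact Function.update_comm h _ _ _

theorem parAll_update_castSucc {k : ℕ} (P : Fin (k + 2) → Proc 0) (i : Fin (k + 1)) (Q : Proc 0) :
    parAll (Function.update P i.castSucc Q) =
      .par (parAll (Function.update (Fin.init P) i Q)) (P (Fin.last _)) := by
  rw [parAll, Fin.init_update_castSucc, Function.update_of_ne (Fin.castSucc_ne_last i).symm]

theorem parAll_update_last {k : ℕ} (P : Fin (k + 2) → Proc 0) (Q : Proc 0) :
    parAll (Function.update P (Fin.last _) Q) = .par (parAll (Fin.init P)) Q := by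
  rw [parAll, Fin.init_update_last, Function.update_self]

theorem init_single_castSucc {k : ℕ} (i : Fin (k + 1)) (μ : Act) :
    Fin.init (single i.castSucc μ) = single i μ := by
  rw [single, Fin.init_update_castSucc]; rfl

theorem single_castSucc_last {k : ℕ} (i : Fin (k + 1)) (μ : Act) :
    single i.castSucc μ (Fin.last _) = none := by
  rw [single, Function.update_of_ne (Fin.castSucc_ne_last i).symm]

theorem ParDeriv.single : ∀ {k : ℕ} {P : Fin k → Proc 0} {i : Fin k} {μ : Act} {Q : Proc 0},
    Trans (P i) μ Q → (∀ l ≠ i, Disjoint μ.bn (P l).fn) →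
      ParDeriv P μ (single i μ) (parAll (Function.update P i Q))
  | 0, _, i, _, _, _, _ => i.elim0
  | 1, P, i, μ, Q, h, _ => by
      obtain rfl : i = 0 := Subsingleton.elim _ _
      simp only [parAll, Function.update_self]
      exact .comp h (by simp [PiCalc.single])
  | k + 2, P, i, μ, Q, h, hd => by
      rcases Fin.eq_castSucc_or_eq_last i with ⟨j, rfl⟩ | rfl
      · rw [parAll_update_castSucc]
        refine .parL ?_ (single_castSucc_last _ _) (hd _ (Fin.castSucc_ne_last j).symm)
        rw [init_single_castSucc]
        exact ParDeriv.single h fun l hl => hd _ (by simpa using hl)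
      · rw [parAll_update_last]
        refine .parR h (by simp [PiCalc.single]) (fun l => ?_) ?_
        · simp only [Fin.init, PiCalc.single]
          rw [Function.update_of_ne (Fin.castSucc_ne_last l)]
        · rw [Finset.disjoint_left]
          intro a ha h'
          obtain ⟨l, hl⟩ := mem_fn_parAll.1 h'
          exact Finset.disjoint_left.1 (hd l.castSucc (Fin.castSucc_ne_last l)) ha hl

theorem init_double_castSucc {k : ℕ} (i j : Fin (k + 1)) (μ ν : Act) :
    Fin.init (double i.castSucc μ j.castSucc ν) = double i μ j ν := by
  rw [double, Fin.init_update_castSucc, init_single_castSucc]; rfl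

theorem init_double_last {k : ℕ} (i : Fin (k + 1)) (μ ν : Act) :
    Fin.init (double i.castSucc μ (Fin.last _) ν) = single i μ := by
  rw [double, Fin.init_update_last, init_single_castSucc]

theorem double_castSucc_last {k : ℕ} (i j : Fin (k + 1)) (μ ν : Act) :
    double i.castSucc μ j.castSucc ν (Fin.last _) = none := by
  rw [double, Function.update_of_ne (Fin.castSucc_ne_last j).symm, single_castSucc_last]

theorem ParDeriv.com : ∀ {k : ℕ} {P : Fin k → Proc 0} {i j : Fin k} {x y : Name} {Q R : Proc 0},
    i ≠ j → Trans (P i) (.out x y) Q → Trans (P j) (.inp x y) R →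
      ParDeriv P .tau (double i (.out x y) j (.inp x y))
        (parAll (Function.update (Function.update P i Q) j R))
  | 0, _, i, _, _, _, _, _, _, _, _ => i.elim0
  | 1, _, i, j, _, _, _, _, h, _, _ => absurd (Subsingleton.elim i j) h
  | k + 2, P, i, j, x, y, Q, R, hij, h, h' => by
      rcases Fin.eq_castSucc_or_eq_last i with ⟨i, rfl⟩ | rfl <;>
      rcases Fin.eq_castSucc_or_eq_last j with ⟨j, rfl⟩ | rfl
      · rw [parAll_update_castSucc, Fin.init_update_castSucc,
          Function.update_of_ne (Fin.castSucc_ne_last i).symm]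
        refine .parL ?_ (double_castSucc_last _ _ _ _) (by simp [Act.bn])
        rw [init_double_castSucc]
        exact ParDeriv.com (by simpa using hij) h h'
      · rw [parAll_update_last, Fin.init_update_castSucc]
        refine .comR (x := x) (y := y) ?_ h' (by simp [double])
        rw [init_double_last]
        exact ParDeriv.single h (by simp [Act.bn])
      · rw [Function.update_comm hij, parAll_update_last, Fin.init_update_castSucc,
          double_comm hij]
        refine .comL (x := x) (y := y) ?_ h (by simp [double])
        rw [init_double_last]
        exact ParDeriv.single h' (by simp [Act.bn])
      · exact absurd rfl hij

/-- The restriction of `y` is created where the later of the two components joins the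
left-associated product. The components further to the right do not contain `y`, so scope expansion
moves the restriction outwards; hence the target is only determined up to congruence. -/
theorem ParDeriv.close : ∀ {k : ℕ} {P : Fin k → Proc 0} {i j : Fin k} {x y : Name} {Q R : Proc 0},
    i ≠ j → Trans (P i) (.bout x y) Q → Trans (P j) (.inp x y) R → (∀ l ≠ i, y ∉ (P l).fn) →
      ∃ X, ParDeriv P .tau (double i (.bout x y) j (.inp x y)) X ∧
        SCong X (.res y (parAll (Function.update (Function.update P i Q) j R)))
  | 0, _, i, _, _, _, _, _, _, _, _, _ => i.elim0
  | 1, _, i, j, _, _, _, _, h, _, _, _ => absurd (Subsingleton.elim i j) h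
  | k + 2, P, i, j, x, y, Q, R, hij, h, h', hy => by
      rcases Fin.eq_castSucc_or_eq_last i with ⟨i, rfl⟩ | rfl <;>
      rcases Fin.eq_castSucc_or_eq_last j with ⟨j, rfl⟩ | rfl
      · obtain ⟨X, hX, hc⟩ := ParDeriv.close (P := Fin.init P) (by simpa using hij) h h'
          fun l hl => hy _ (by simpa using hl)
        rw [parAll_update_castSucc, Fin.init_update_castSucc,
          Function.update_of_ne (Fin.castSucc_ne_last i).symm]
        refine ⟨_, .parL (R := X) ?_ (double_castSucc_last _ _ _ _) (by simp [Act.bn]), ?_⟩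
        · rwa [init_double_castSucc]
        · refine .trans (.par hc (.refl _)) (.trans (.scope _ _) ?_)
          rw [← Proc.close_of_notMem (hy _ (Fin.castSucc_ne_last i).symm)]
          exact .refl _
      · rw [parAll_update_last, Fin.init_update_castSucc]
        refine ⟨_, .closeR (x := x) (y := y) ?_ h' (by simp [double]) (hy _ hij.symm), .refl _⟩
        rw [init_double_last]
        exact ParDeriv.single h fun l hl => by
          simpa [Act.bn, Fin.init] using hy l.castSucc (by simpa using hl)
      · rw [Function.update_comm hij, parAll_update_last, Fin.init_update_castSucc,
          double_comm hij]
        refine ⟨_, .closeL (x := x) (y := y) ?_ h (by simp [double]) ?_, .refl _⟩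
        · rw [init_double_last]
          exact ParDeriv.single h' (by simp [Act.bn])
        · rw [mem_fn_parAll]
          rintro ⟨l, hl⟩
          exact hy _ (Fin.castSucc_ne_last l) hl
      · exact absurd rfl hij

/-- The channel on which a visible action takes place. -/
def Act.chan : Act → Option Name
  | .inp x _ => some x
  | .out x _ => some x
  | .bout x _ => some x
  | .tau => none

/-- Every transition of a parallel composition comes from a component moving alone, or from a
communication of two components. -/
theorem ParDeriv.cases_active {k : ℕ} {P : Fin k → Proc 0} {μ : Act} {c : Fin k → Option Act}
    {X : Proc 0} (h : ParDeriv P μ c X) :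
    (∃ i Q, Trans (P i) μ Q) ∨ (μ = .tau ∧ ∃ i j, i ≠ j ∧ ∃ x y Q R, Trans (P j) (.inp x y) R ∧
      (Trans (P i) (.out x y) Q ∨ Trans (P i) (.bout x y) Q)) := by
  induction h with
  | comp h => exact .inl ⟨_, _, h⟩
  | parL _ _ _ ih =>
    rcases ih with ⟨i, Q, h⟩ | ⟨h, i, j, hij, x, y, Q, R, h'⟩
    · exact .inl ⟨i.castSucc, Q, h⟩
    · exact .inr ⟨h, i.castSucc, j.castSucc, by simpa using hij, x, y, Q, R, h'⟩
  | parR h => exact .inl ⟨_, _, h⟩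
  -- The inner action is visible, so the induction hypothesis cannot be in its communication case,
  -- which carries the equation with `τ` for this purpose. The next three cases are alike.
  | comL _ h _ ih =>
    rcases ih with ⟨i, Q, h'⟩ | ⟨h, _⟩
    · exact .inr ⟨rfl, Fin.last _, i.castSucc, (Fin.castSucc_ne_last i).symm, _, _, _, _, h', .inl h⟩
    · cases h
  | comR _ h _ ih =>
    rcases ih with ⟨i, Q, h'⟩ | ⟨h, _⟩
    · exact .inr ⟨rfl, i.castSucc, Fin.last _, Fin.castSucc_ne_last i, _, _, _, _, h, .inl h'⟩
    · cases h
  | closeL _ h _ _ ih =>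
    rcases ih with ⟨i, Q, h'⟩ | ⟨h, _⟩
    · exact .inr ⟨rfl, Fin.last _, i.castSucc, (Fin.castSucc_ne_last i).symm, _, _, _, _, h', .inr h⟩
    · cases h
  | closeR _ h _ _ ih =>
    rcases ih with ⟨i, Q, h'⟩ | ⟨h, _⟩
    · exact .inr ⟨rfl, i.castSucc, Fin.last _, Fin.castSucc_ne_last i, _, _, _, _, h, .inr h'⟩
    · cases h

/-- Only the channel of the action is compared, because opening a restriction turns a free output
into a bound one on the same channel. -/
theorem NetDeriv.exists_parDeriv {k : ℕ} {P : Fin k → Proc 0} {xs : List Name} {μ : Act}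
    {c : Fin k → Option Act} {X : Proc 0} (h : NetDeriv P xs μ c X) :
    ∃ ν Y, ParDeriv P ν c Y ∧ ν.chan = μ.chan ∧ ∀ x ∈ ν.chan, x ∉ xs := by
  induction h with
  | par h => exact ⟨_, _, h, rfl, by simp⟩
  | @res x xs μ _ _ _ hx ih =>
    obtain ⟨ν, Y, h, e, hn⟩ := ih
    refine ⟨ν, Y, h, e, fun z hz => ?_⟩
    rw [List.mem_cons, not_or]
    refine ⟨?_, hn z hz⟩
    rintro rfl
    rw [e] at hz
    cases μ <;> simp_all [Act.chan, Act.names]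
  | @opn z x xs _ _ _ hx ih =>
    obtain ⟨ν, Y, h, e, hn⟩ := ih
    refine ⟨ν, Y, h, e, fun w hw => ?_⟩
    rw [List.mem_cons, not_or]
    refine ⟨?_, hn w hw⟩
    rintro rfl
    rw [e] at hw
    simp_all [Act.chan]

theorem NetDeriv.resAll {k : ℕ} {P : Fin k → Proc 0} {xs : List Name} {μ : Act}
    {c : Fin k → Option Act} {X : Proc 0} (h : ParDeriv P μ c X) (hx : ∀ x ∈ xs, x ∉ μ.names) :
    NetDeriv P xs μ c (PiCalc.resAll xs X) := by
  induction xs with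
  | nil => exact .par h
  | cons x xs ih => exact .res (ih fun y hy => hx y (by simp [hy])) (hx x (by simp))

theorem NetDeriv.opnAll {k : ℕ} {P : Fin k → Proc 0} {xs : List Name} {x y : Name}
    {c : Fin k → Option Act} {X : Proc 0} (h : ParDeriv P (.out x y) c X) (hx : x ∉ xs)
    (hn : xs.Nodup) (hy : y ∈ xs) : NetDeriv P xs (.bout x y) c (PiCalc.resAll (xs.erase y) X) := by
  induction xs with
  | nil => simp at hy
  | cons z xs ih =>
    simp only [List.mem_cons, not_or] at hx
    rw [List.nodup_cons] at hn
    by_cases e : y = z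
    · subst e
      rw [List.erase_cons_head]
      refine .opn (.resAll h fun w hw => ?_) hx.1
      simp only [Act.names, Finset.mem_insert, Finset.mem_singleton, not_or]
      exact ⟨fun e => hx.2 (e ▸ hw), fun e => hn.1 (e ▸ hw)⟩
    · have hy' : y ∈ xs := by simpa [e] using hy
      rw [List.erase_cons_tail (by simpa using Ne.symm e)]
      refine .res (ih hx.2 hn.2 hy') ?_
      simp only [Act.names, Finset.mem_insert, Finset.mem_singleton, not_or]
      exact ⟨Ne.symm hx.1, Ne.symm e⟩

theorem SCong.res {P Q : Proc 0} (y : Name) (h : SCong P Q) : SCong (.res y P) (.res y Q) :=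
  .nu (h.rename _)

theorem SCong.resAll {P Q : Proc 0} (xs : List Name) (h : SCong P Q) :
    SCong (PiCalc.resAll xs P) (PiCalc.resAll xs Q) := by
  induction xs with
  | nil => exact h
  | cons x xs ih => exact .res x ih

/-! ### Steps of networks -/

namespace Network

variable {k : ℕ}

theorem AlphaEquiv.refl (N : Network k) : N.AlphaEquiv N :=
  ⟨1, by simp, by simp, fun i => by rw [Equiv.Perm.coe_one, Proc.mapNames_id]⟩

/-- The network with another family of components. -/
def withComp (N : Network k) (F : Fin k → Proc 0) : Network k := { N with comp := F }

theorem step_single {N : Network k} {i : Fin k} {μ : Act} {Q : Proc 0}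
    (h : Trans (N.comp i) μ Q) (hd : ∀ l ≠ i, Disjoint μ.bn (N.comp l).fn)
    (hv : ∀ y ∈ μ.bn, y.IsVar) (hb : ∀ x ∈ N.bound, x ∉ μ.names) :
    N.Step μ (single i μ) (N.withComp (Function.update N.comp i Q)) :=
  ⟨hv, N, _, .refl N, .resAll (.single h hd) hb, .refl _⟩

/-- The network in which the name `y` is no longer bound. -/
def unbind (N : Network k) (y : Name) : Network k :=
  { N with
    bound := N.bound.erase y
    bound_nodup := N.bound_nodup.erase y
    bound_isVar := fun x hx => N.bound_isVar x (List.mem_of_mem_erase hx) }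

/-- The contribution is a free output in either case. The label is a bound output exactly when the
transmitted name is still bound, and the name is then released from the network. -/
theorem step_out {N : Network k} {i : Fin k} {x y : Name} {Q : Proc 0}
    (h : Trans (N.comp i) (.out x y) Q) (hx : x ∉ N.bound) :
    ∃ μ, N.Step μ (single i (.out x y)) ((N.unbind y).withComp (Function.update N.comp i Q)) ∧
      (y ∉ N.bound → μ = .out x y) := by
  by_cases hy : y ∈ N.bound
  · refine ⟨.bout x y, ⟨?_, N, _, .refl N, .opnAll (.single h (by simp [Act.bn])) hx
      N.bound_nodup hy, .refl _⟩, fun h => absurd hy h⟩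
    simpa [Act.bn] using N.bound_isVar y hy
  · refine ⟨.out x y, ⟨by simp [Act.bn], N, _, .refl N,
      .resAll (.single h (by simp [Act.bn])) fun z hz => ?_, ?_⟩, fun _ => rfl⟩
    · simp only [Act.names, Finset.mem_insert, Finset.mem_singleton, not_or]
      exact ⟨fun e => hx (e ▸ hz), fun e => hy (e ▸ hz)⟩
    · simp only [toProc, withComp, unbind, List.erase_of_not_mem hy]
      exact .refl _

theorem step_com {N : Network k} {i j : Fin k} (hij : i ≠ j) {x y : Name} {Q R : Proc 0}
    (h : Trans (N.comp i) (.out x y) Q) (h' : Trans (N.comp j) (.inp x y) R) :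
    N.Step .tau (double i (.out x y) j (.inp x y))
      (N.withComp (Function.update (Function.update N.comp i Q) j R)) :=
  ⟨by simp [Act.bn], N, _, .refl N, .resAll (.com hij h h') (by simp [Act.names]), .refl _⟩

/-- The network in which the fresh name `y` is bound, too. -/
def bind (N : Network k) (y : Name) (hy : y ∉ N.bound) (hv : y.IsVar) : Network k :=
  { N with
    bound := N.bound ++ [y]
    bound_nodup := by
      rw [List.nodup_append]
      exact ⟨N.bound_nodup, by simp, by rintro a ha b hb rfl; simp at hb; exact hy (hb ▸ ha)⟩
    bound_isVar := by
      intro x hx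
      rcases List.mem_append.1 hx with hx | hx
      · exact N.bound_isVar x hx
      · rw [List.mem_singleton] at hx
        exact hx ▸ hv }

theorem step_close {N : Network k} {i j : Fin k} (hij : i ≠ j) {x y : Name} {Q R : Proc 0}
    (h : Trans (N.comp i) (.bout x y) Q) (h' : Trans (N.comp j) (.inp x y) R)
    (hf : ∀ l ≠ i, y ∉ (N.comp l).fn) (hy : y ∉ N.bound) (hv : y.IsVar) :
    N.Step .tau (double i (.bout x y) j (.inp x y))
      ((N.bind y hy hv).withComp (Function.update (Function.update N.comp i Q) j R)) := by
  obtain ⟨X, hX, hc⟩ := ParDeriv.close hij h h' hf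
  refine ⟨by simp [Act.bn], N, _, .refl N, .resAll hX (by simp [Act.names]), ?_⟩
  refine (hc.resAll _).trans ?_
  simp only [toProc, withComp, bind, resAll, List.foldr_append, List.foldr_cons, List.foldr_nil]
  exact .refl _

/-- If a network has a step, then one of its components has a silent transition or a visible
action on a channel that is not bound, or two components can communicate on a bound channel. -/
theorem Step.cases_active {N N' : Network k} {μ : Act} {c : Fin k → Option Act}
    (h : N.Step μ c N') :
    (∃ i Q, Trans (N.comp i) .tau Q) ∨
    (∃ i x, x ∉ N.bound ∧ (N.comp i).CanIn (.free x)) ∨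
    (∃ i x y, x ∉ N.bound ∧ (N.comp i).CanOut (.free x) (.free y)) ∨
    (∃ i x, x ∉ N.bound ∧ (N.comp i).CanBOut (.free x)) ∨
    (∃ i j x, i ≠ j ∧ x ∈ N.bound ∧ (N.comp j).CanIn (.free x) ∧
      ((∃ y, (N.comp i).CanOut (.free x) (.free y)) ∨ (N.comp i).CanBOut (.free x))) := by
  obtain ⟨-, M, X, ⟨π, -, hb, hc⟩, hd, -⟩ := h
  -- The alpha-conversion of the source is undone by the inverse permutation, so that everything is
  -- read off from `N` itself.
  have hcomp : ∀ i, N.comp i = (M.comp i).mapNames π.symm := fun i => by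
    rw [hc, Proc.mapNames_mapNames, Equiv.symm_comp_self, Proc.mapNames_id]
  have hT : ∀ {i μ Q}, Trans (M.comp i) μ Q →
      Trans (N.comp i) (μ.map π.symm) (Q.mapNames π.symm) := fun {i μ Q} h => by
    rw [hcomp]; exact h.mapNames π.symm.injective
  have hbound : ∀ {x}, x ∉ M.bound → π.symm x ∉ N.bound := fun {x} h h' => by
    rw [hb, List.mem_map] at h
    exact h ⟨_, h', by simp⟩
  obtain ⟨ν, Y, hp, -, hn⟩ := hd.exists_parDeriv
  rcases hp.cases_active with ⟨i, Q, h⟩ | ⟨-, i, j, hij, x, y, Q, R, h, h'⟩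
  · cases ν with
    | tau => exact .inl ⟨i, _, hT h⟩
    | inp x y => exact .inr (.inl ⟨i, _, hbound (hn x (by simp [Act.chan])), (hT h).can⟩)
    | out x y => exact .inr (.inr (.inl ⟨i, _, _, hbound (hn x (by simp [Act.chan])), (hT h).can⟩))
    | bout x y =>
      exact .inr (.inr (.inr (.inl ⟨i, _, hbound (hn x (by simp [Act.chan])), (hT h).can⟩)))
  -- A communication on an unbound channel is discarded in favour of its input, which is possible as
  -- a visible step.
  · by_cases hx : π.symm x ∈ N.bound
    · refine .inr (.inr (.inr (.inr ⟨i, j, _, hij, hx, (hT h).can, ?_⟩)))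
      rcases h' with h' | h'
      · exact .inl ⟨π.symm y, (hT h').can⟩
      · exact .inr (hT h').can
    · exact .inr (.inl ⟨j, _, hx, (hT h).can⟩)

end Network

/-! ### Rotations: permutations of the names and a cyclic permutation of the components -/

/-- A cyclic permutation `node` of the components and a compatible permutation `name` of the names,
of order dividing `k`, with arbitrarily fresh orbits of length `k`. -/
structure Rotation (k : ℕ) where
  node : Equiv.Perm (Fin k)
  name : Equiv.Perm Name
  isCycleOn : node.IsCycleOn (Finset.univ : Finset (Fin k))
  name_pow : name ^ k = 1
  name_out : name .out = .out
  name_num : ∀ n : Fin k, name (.num n) = .num (node n)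
  fresh : ∀ F : Finset Name, ∃ y : Fin k → Name, Function.Injective y ∧
    (∀ i, y (node i) = name (y i)) ∧ (∀ i, y i ∉ F) ∧ ∀ i, (y i).IsVar

namespace Rotation

variable {k : ℕ} (s : Rotation k)

theorem exists_pow_eq (i j : Fin k) : ∃ n : ℕ, (s.node ^ n) i = j := by
  obtain ⟨n, -, h⟩ := s.isCycleOn.exists_pow_eq (Finset.mem_univ i) (Finset.mem_univ j)
  exact ⟨n, h⟩

theorem induct {p : Fin k → Prop} (i : Fin k) (hi : p i) (h : ∀ l, p l → p (s.node l)) (l : Fin k) :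
    p l := by
  obtain ⟨n, rfl⟩ := s.exists_pow_eq i l
  induction n with
  | zero => exact hi
  | succ n ih => rw [pow_succ']; exact h _ ih

/-- An object fixed by the `k`-th iterate of `g` extends to a family on which `node` acts as `g`. -/
theorem exists_family {α : Type*} {g : α → α} (hg : g^[k] = id) (i : Fin k) (q : α) :
    ∃ f : Fin k → α, f i = q ∧ ∀ l, f (s.node l) = g (f l) := by
  choose n hn using fun l => s.exists_pow_eq i l
  -- Two exponents that lead from `i` to the same node are congruent modulo `k`, so the family does
  -- not depend on the chosen exponents.
  have key : ∀ {a b : ℕ}, (s.node ^ a) i = (s.node ^ b) i → g^[a] q = g^[b] q := by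
    intro a b h
    have h := (s.isCycleOn.pow_apply_eq_pow_apply (Finset.mem_univ i)).1 h
    rw [Finset.card_fin] at h
    have hmod : ∀ c : ℕ, g^[c] q = g^[c % k] q := fun c => by
      conv_lhs => rw [← Nat.mod_add_div c k, Function.iterate_add_apply, Function.iterate_mul, hg,
        Function.iterate_id, id]
    rw [hmod a, hmod b, h]
  refine ⟨fun l => g^[n l] q, ?_, fun l => ?_⟩
  · exact key (b := 0) (hn i)
  · rw [← Function.iterate_succ_apply' g]
    apply key
    rw [hn, pow_succ', Equiv.Perm.mul_apply, hn]

theorem name_iterate : s.name^[k] = id := by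
  rw [← Equiv.Perm.coe_pow, s.name_pow, Equiv.Perm.coe_one]

theorem mapNames_iterate : (fun P : Proc 0 => P.mapNames s.name)^[k] = id := by
  have : ∀ n : ℕ, (fun P : Proc 0 => P.mapNames s.name)^[n] = fun P => P.mapNames (s.name^[n]) := by
    intro n
    induction n with
    | zero => funext P; simp
    | succ n ih =>
      funext P
      rw [Function.iterate_succ_apply', ih, Proc.mapNames_mapNames, ← Function.iterate_succ']
  rw [this, name_iterate]
  funext P; simp

theorem node_ne (hk : 2 ≤ k) (l : Fin k) : s.node l ≠ l := by
  intro h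
  have := (s.isCycleOn.pow_apply_eq (Finset.mem_univ l) (n := 1)).1 (by simpa using h)
  rw [Finset.card_fin, Nat.dvd_one] at this
  omega

/-- A network that is invariant under the rotation. -/
structure Invariant (N : Network k) : Prop where
  isSeparate : N.IsSeparate
  comp : ∀ i, N.comp (s.node i) = (N.comp i).mapNames s.name
  bound : ∀ x, x ∈ N.bound ↔ s.name x ∈ N.bound

end Rotation

/-! ### Runs -/

/-- A step of a network with its label, contributions and target. -/
abbrev Entry (k : ℕ) : Type := Act × (Fin k → Option Act) × Network k

/-- Finite sequences of steps of networks. -/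
inductive Run {k : ℕ} (N : Network k) : List (Entry k) → Network k → Prop
  | nil : Run N [] N
  | snoc {l : List (Entry k)} {N' N'' : Network k} {μ : Act} {c : Fin k → Option Act} :
      Run N l N' → N'.Step μ c N'' → Run N (l ++ [(μ, c, N'')]) N''

theorem Run.append {k : ℕ} {N N' N'' : Network k} {l l' : List (Entry k)} (h : Run N l N')
    (h' : Run N' l' N'') : Run N (l ++ l') N'' := by
  induction h' with
  | nil => simpa using h
  | snoc _ hs ih => rw [← List.append_assoc]; exact .snoc ih hs

/-- No leader is elected by the steps in `l`: if a component announces `n`, then the name of some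
other component is announced visibly. -/
def Undecided {k : ℕ} (l : List (Entry k)) : Prop :=
  ∀ t ∈ l, ∀ (i n : Fin k), t.2.1 i = some (.out .out (.num n)) →
    ∃ m : ℕ, m ≠ n ∧ ∃ t' ∈ l, t'.1 = .out .out (.num m)

theorem Undecided.append {k : ℕ} {l l' : List (Entry k)} (h : Undecided l) (h' : Undecided l') :
    Undecided (l ++ l') := by
  intro t ht i n hn
  rcases List.mem_append.1 ht with ht | ht
  · obtain ⟨m, hm, t', h1, h2⟩ := h t ht i n hn
    exact ⟨m, hm, t', by simp [h1], h2⟩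
  · obtain ⟨m, hm, t', h1, h2⟩ := h' t ht i n hn
    exact ⟨m, hm, t', by simp [h1], h2⟩

/-- Runs with one step for every element of `Fin k`, in some order. -/
theorem Run.exists_of_steps {k : ℕ} {Good : Finset (Fin k) → Network k → Prop}
    {p : Fin k → Act → (Fin k → Option Act) → Prop} {N : Network k} (h0 : Good ∅ N)
    (hs : ∀ A N' e, Good A N' → e ∉ A → ∃ μ c N'', N'.Step μ c N'' ∧ Good (insert e A) N'' ∧ p e μ c) :
    ∃ l N', Run N l N' ∧ Good Finset.univ N' ∧ (∀ e, ∃ t ∈ l, p e t.1 t.2.1) ∧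
      ∀ t ∈ l, ∃ e, p e t.1 t.2.1 := by
  suffices h : ∀ A : Finset (Fin k), ∃ l N', Run N l N' ∧ Good A N' ∧
      (∀ e ∈ A, ∃ t ∈ l, p e t.1 t.2.1) ∧ ∀ t ∈ l, ∃ e, p e t.1 t.2.1 by
    obtain ⟨l, N', h1, h2, h3, h4⟩ := h Finset.univ
    exact ⟨l, N', h1, h2, fun e => h3 e (Finset.mem_univ e), h4⟩
  intro A
  induction A using Finset.induction_on with
  | empty => exact ⟨[], N, .nil, h0, by simp, by simp⟩
  | insert e A he ih =>
    obtain ⟨l, N', h1, h2, h3, h4⟩ := ih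
    obtain ⟨μ, c, N'', h5, h6, h7⟩ := hs A N' e h2 he
    refine ⟨_, N'', h1.snoc h5, h6, fun e' he' => ?_, fun t ht => ?_⟩
    · rcases Finset.mem_insert.1 he' with rfl | he'
      · exact ⟨(μ, c, N''), by simp, h7⟩
      · obtain ⟨t, ht, h⟩ := h3 e' he'
        exact ⟨t, by simp [ht], h⟩
    · rcases List.mem_append.1 ht with ht | ht
      · exact h4 t ht
      · rw [List.mem_singleton] at ht
        subst ht
        exact ⟨e, h7⟩

/-! ### Invariant rounds -/

namespace Rotation.Invariant

variable {k : ℕ} {s : Rotation k} {N : Network k} (h : s.Invariant N)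

include h

theorem trans_node {i : Fin k} {μ : Act} {Q : Proc 0} (hT : Trans (N.comp i) μ Q) :
    Trans (N.comp (s.node i)) (μ.map s.name) (Q.mapNames s.name) := by
  rw [h.comp]; exact hT.mapNames s.name.injective

end Rotation.Invariant

theorem Proc.CanIn.mapNames {P : Proc 0} {x : Name} (h : P.CanIn (.free x)) (f : Name → Name) :
    (P.mapNames f).CanIn (.free (f x)) := by
  rw [Proc.mapNames_eq]; exact (Proc.canIn_rename _).2 ⟨_, rfl, h⟩

/-- The network `N` admits a nonempty run to an invariant network that elects no leader. -/
def Rotation.HasRound {k : ℕ} (s : Rotation k) (N : Network k) : Prop :=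
  ∃ l N', Run N l N' ∧ l ≠ [] ∧ s.Invariant N' ∧ Undecided l

namespace Rotation.Invariant

variable {k : ℕ} {s : Rotation k} {N : Network k}

/-- The round in which every component performs once an action that is not a free output. -/
theorem round_single (h : s.Invariant N) (i : Fin k) {μ : Fin k → Act} {F : Fin k → Proc 0}
    (hF : ∀ l, F (s.node l) = (F l).mapNames s.name) (hT : ∀ l, Trans (N.comp l) (μ l) (F l))
    (hb : ∀ l, ∀ x ∈ N.bound, x ∉ (μ l).names) (hv : ∀ l, ∀ y ∈ (μ l).bn, y.IsVar)
    (hd : ∀ l m, m ≠ l → Disjoint (μ l).bn (N.comp m).fn ∧ Disjoint (μ l).bn (F m).fn)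
    (hout : ∀ l x y, μ l ≠ .out x y) : s.HasRound N := by
  obtain ⟨l, N', hr, ⟨hc, hbd⟩, hne, hp⟩ := Run.exists_of_steps (N := N)
    (Good := fun A N' => (∀ m, N'.comp m = if m ∈ A then F m else N.comp m) ∧ N'.bound = N.bound)
    (p := fun e _ c => c = single e (μ e)) (by simp) (fun A N' e hg he => by
      refine ⟨μ e, _, _, Network.step_single (i := e) (Q := F e) ?_ ?_ (hv e) ?_, ⟨?_, hg.2⟩, rfl⟩
      · rw [hg.1, if_neg he]; exact hT e
      · intro m hm
        rw [hg.1]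
        split_ifs
        exacts [(hd e m hm).2, (hd e m hm).1]
      · rw [hg.2]; exact hb e
      · intro m
        simp only [Network.withComp]
        by_cases hm : m = e
        · subst hm; simp
        · rw [Function.update_of_ne hm, hg.1]; simp [hm])
  have hc : N'.comp = F := by funext m; simpa using hc m
  refine ⟨l, N', hr, ?_, ⟨fun m => ?_, fun m => ?_, fun x => ?_⟩, ?_⟩
  · rintro rfl
    simpa using hne i
  · rw [hc]; exact (hT m).isSeparate (h.isSeparate m)
  · rw [hc]; exact hF m
  · rw [hbd]; exact h.bound x
  · intro t ht j n hn
    obtain ⟨e, he⟩ := hp t ht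
    rw [he] at hn
    exact absurd (single_eq_some hn).2.symm (hout _ _ _)

theorem round_tau (h : s.Invariant N) {i : Fin k} {Q : Proc 0} (hQ : Trans (N.comp i) .tau Q) :
    s.HasRound N := by
  obtain ⟨F, hi, hF⟩ := s.exists_family s.mapNames_iterate i Q
  refine h.round_single i (μ := fun _ => .tau) hF
    (s.induct i (hi ▸ hQ) fun l hl => ?_) (by simp [Act.names]) (by simp [Act.bn])
    (by simp [Act.bn]) (by simp)
  rw [hF]
  exact h.trans_node hl

theorem round_in (h : s.Invariant N) {i : Fin k} {x : Name} (hx : x ∉ N.bound)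
    (hc : (N.comp i).CanIn (.free x)) : s.HasRound N := by
  obtain ⟨A, hA⟩ := hc.exists_tIn
  -- In an early input the received name is free to choose. `out` is fixed by the rotation and is
  -- never bound, so the same name serves for all components.
  obtain ⟨F, hi, hF⟩ := s.exists_family s.mapNames_iterate i (A.inst .out)
  obtain ⟨xs, hxi, hxs⟩ := s.exists_family s.name_iterate i x
  have hxb : ∀ l, xs l ∉ N.bound :=
    s.induct i (hxi ▸ hx) fun l hl => by rwa [hxs, ← h.bound]
  refine h.round_single i (μ := fun l => .inp (xs l) .out) hF
    (s.induct i (hi ▸ hxi ▸ hA.trans _) fun l hl => ?_) (fun l y hy => ?_) (by simp [Act.bn])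
    (by simp [Act.bn]) (by simp)
  · rw [hF, hxs]
    simpa only [Act.map, s.name_out] using h.trans_node hl
  · simp only [Act.names, Finset.mem_insert, Finset.mem_singleton, not_or]
    exact ⟨fun e => hxb l (e ▸ hy), fun e => by simpa [e, Name.IsVar] using N.bound_isVar y hy⟩

/-- Equivariant families of distinct names that are bound variables and fresh for a network. -/
theorem exists_fresh (s : Rotation k) (N : Network k) (F : Finset Name) :
    ∃ y : Fin k → Name, Function.Injective y ∧ (∀ i, y (s.node i) = s.name (y i)) ∧
      (∀ i, (y i).IsVar) ∧ (∀ i, y i ∉ N.bound) ∧ (∀ i l, y i ∉ (N.comp l).fn) ∧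
      ∀ i, y i ∉ F := by
  obtain ⟨y, h1, h2, h3, h4⟩ := s.fresh (N.bound.toFinset ∪
    Finset.univ.biUnion (fun l => (N.comp l).fn) ∪ F)
  simp only [Finset.mem_union, List.mem_toFinset, Finset.mem_biUnion, Finset.mem_univ, true_and,
    not_or, not_exists] at h3
  exact ⟨y, h1, h2, h4, fun i => (h3 i).1.1, fun i => (h3 i).1.2, fun i => (h3 i).2⟩

/-- The extruded names form an orbit of `k` distinct fresh names. Distinctness keeps each of them
fresh for the components that have already extruded theirs. -/
theorem round_bout (h : s.Invariant N) {i : Fin k} {x : Name} (hx : x ∉ N.bound)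
    (hc : (N.comp i).CanBOut (.free x)) : s.HasRound N := by
  obtain ⟨A, hA⟩ := hc.exists_tBOut
  obtain ⟨xs, hxi, hxs⟩ := s.exists_family s.name_iterate i x
  obtain ⟨y, hinj, hy, hyv, hyb, hyf, hyx⟩ := exists_fresh s N {x}
  obtain ⟨F, hi, hF⟩ := s.exists_family s.mapNames_iterate i (A.inst (y i))
  have hxb : ∀ l, xs l ∉ N.bound :=
    s.induct i (hxi ▸ hx) fun l hl => by rwa [hxs, ← h.bound]
  have hfn : ∀ l, (F l).fn ⊆ insert (y l) (N.comp l).fn := by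
    refine s.induct i ?_ fun l hl => ?_
    · rw [hi]
      exact (Proc.fn_inst_subset _ _).trans (Finset.insert_subset_insert _ hA.fn_subset)
    · rw [hF, h.comp, hy, Proc.fn_mapNames, Proc.fn_mapNames, ← Finset.image_insert]
      exact Finset.image_subset_image hl
  refine h.round_single i (μ := fun l => .bout (xs l) (y l)) hF
    (s.induct i ?_ fun l hl => ?_) (fun l z hz => ?_) ?_ (fun l m hm => ?_) (by simp)
  · rw [hi, hxi]
    exact hA.trans (hyf i i) (by simpa using hyx i)
  · rw [hF, hxs, hy]
    exact h.trans_node hl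
  · simp only [Act.names, Finset.mem_insert, Finset.mem_singleton, not_or]
    exact ⟨fun e => hxb l (e ▸ hz), fun e => hyb l (e ▸ hz)⟩
  · simpa [Act.bn] using hyv
  · simp only [Act.bn, Finset.disjoint_singleton_left]
    refine ⟨hyf l m, fun h' => ?_⟩
    rcases Finset.mem_insert.1 (hfn m h') with e | h'
    · exact hm (hinj e).symm
    · exact hyf l m h'

/-- Several components may transmit the same bound name: the first of them extrudes it and the later
ones output it as a free name. This is why the label of a step is only prescribed when the name is
not bound in `N`. -/
theorem round_out (hk : 2 ≤ k) (h : s.Invariant N) {i : Fin k} {x y : Name} (hx : x ∉ N.bound)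
    (hc : (N.comp i).CanOut (.free x) (.free y)) : s.HasRound N := by
  obtain ⟨A, hA⟩ := hc.exists_tOut
  obtain ⟨xs, hxi, hxs⟩ := s.exists_family s.name_iterate i x
  obtain ⟨ys, hyi, hys⟩ := s.exists_family s.name_iterate i y
  obtain ⟨F, hi, hF⟩ := s.exists_family s.mapNames_iterate i A
  have hxb : ∀ l, xs l ∉ N.bound :=
    s.induct i (hxi ▸ hx) fun l hl => by rwa [hxs, ← h.bound]
  have hT : ∀ l, Trans (N.comp l) (.out (xs l) (ys l)) (F l) := by
    refine s.induct i ?_ fun l hl => ?_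
    · rw [hi, hxi, hyi]
      exact hA.trans
    · rw [hF, hxs, hys]
      exact h.trans_node hl
  obtain ⟨l, N', hr, ⟨hc, hbd⟩, hne, hp⟩ := Run.exists_of_steps (N := N)
    (Good := fun A N' => (∀ m, N'.comp m = if m ∈ A then F m else N.comp m) ∧
      ∀ z, z ∈ N'.bound ↔ z ∈ N.bound ∧ ∀ e ∈ A, z ≠ ys e)
    (p := fun e μ c => c = single e (.out (xs e) (ys e)) ∧
      (ys e ∉ N.bound → μ = .out (xs e) (ys e))) (by simp) (fun A N' e hg he => by
      obtain ⟨μ, hs, hμ⟩ := Network.step_out (N := N') (i := e) (Q := F e) (x := xs e) (y := ys e)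
        (by rw [hg.1, if_neg he]; exact hT e) (fun h' => hxb e ((hg.2 _).1 h').1)
      refine ⟨μ, _, _, hs, ⟨fun m => ?_, fun z => ?_⟩, rfl, fun h' => hμ fun h'' =>
        h' ((hg.2 _).1 h'').1⟩
      · simp only [Network.withComp]
        by_cases hm : m = e
        · subst hm; simp
        · rw [Function.update_of_ne hm, hg.1]; simp [hm]
      · simp only [Network.withComp, Network.unbind, N'.bound_nodup.mem_erase_iff, hg.2,
          Finset.forall_mem_insert]
        tauto)
  have hc : N'.comp = F := by funext m; simpa using hc m
  refine ⟨l, N', hr, ?_, ⟨fun m => ?_, fun m => ?_, fun z => ?_⟩, ?_⟩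
  · rintro rfl
    simpa using hne i
  · rw [hc]; exact (hT m).isSeparate (h.isSeparate m)
  · rw [hc]; exact hF m
  · rw [hbd, hbd, ← h.bound]
    simp only [Finset.mem_univ, forall_const]
    -- The released names are values of the equivariant family `ys`, and the set of these values is
    -- invariant under the rotation.
    refine and_congr_right fun _ => ⟨fun h' e he => ?_, fun h' e he => ?_⟩
    · refine h' (s.node.symm e) (s.name.injective ?_)
      rw [he, ← hys, Equiv.apply_symm_apply]
    · exact h' (s.node e) (by rw [he, hys])
  · intro t ht j n hn
    obtain ⟨e, he, -⟩ := hp t ht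
    rw [he] at hn
    have := (single_eq_some hn).2
    simp only [Act.out.injEq] at this
    -- The contradicting announcement is that of the successor of `e`. It is visible, because a
    -- number is never a bound name.
    obtain ⟨t', ht', -, hμ⟩ := hne (s.node e)
    have hy : ys (s.node e) = .num (s.node n) := by rw [hys, ← this.2, s.name_num]
    have hx : xs (s.node e) = .out := by rw [hxs, ← this.1, s.name_out]
    rw [hx, hy] at hμ
    refine ⟨s.node n, fun e => s.node_ne hk n (Fin.ext e), t', ht', hμ fun h' => ?_⟩
    simpa [Name.IsVar] using N.bound_isVar _ h'

-- Rounds of communications along a shift of the cycle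

/-- The components after the communications in `A`, in which the component `e ∈ A` sends to the
component `τ e`. -/
def square (τ : Equiv.Perm (Fin k)) (P Q R S : Fin k → Proc 0) (A : Finset (Fin k)) (m : Fin k) :
    Proc 0 :=
  if m ∈ A then (if τ.symm m ∈ A then S m else Q m) else (if τ.symm m ∈ A then R m else P m)

/-- A component has sent if it lies in `A`, and has received if its sender does. Adding `e` to `A`
thus changes these two conditions only at `e` and at `τ e`, which are different components. -/
theorem update_square {τ : Equiv.Perm (Fin k)} {P Q R S : Fin k → Proc 0} {A : Finset (Fin k)}
    {e : Fin k} (he : e ∉ A) (hτ : τ e ≠ e) :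
    Function.update (Function.update (square τ P Q R S A) e (if τ.symm e ∈ A then S e else Q e))
      (τ e) (if τ e ∈ A then S (τ e) else R (τ e)) = square τ P Q R S (insert e A) := by
  funext m
  by_cases h1 : m = τ e
  · subst h1
    simp [square, hτ]
  · rw [Function.update_of_ne h1]
    have h1' : τ.symm m ≠ e := fun h => h1 (by rw [← h, Equiv.apply_symm_apply])
    by_cases h2 : m = e
    · subst h2
      simp [square, h1']
    · rw [Function.update_of_ne h2]
      simp [square, h1', h2]

/-- The shift is the power of the cycle that takes `i` to `j`. Being a power it commutes with the
cycle, and so one point that is moved implies that all points are moved. -/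
theorem exists_shift (s : Rotation k) {i j : Fin k} (hij : i ≠ j) :
    ∃ τ : Equiv.Perm (Fin k), τ i = j ∧ (∀ l, τ (s.node l) = s.node (τ l)) ∧ ∀ l, τ l ≠ l := by
  obtain ⟨n, hn⟩ := s.exists_pow_eq i j
  have hcomm : ∀ l, (s.node ^ n) (s.node l) = s.node ((s.node ^ n) l) := fun l => by
    rw [← Equiv.Perm.mul_apply, ← pow_succ, pow_succ', Equiv.Perm.mul_apply]
  refine ⟨s.node ^ n, hn, hcomm, s.induct i (hn ▸ hij.symm) fun l hl => ?_⟩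
  rw [hcomm]
  exact s.node.injective.ne hl

end Rotation.Invariant

namespace Rotation.Invariant

variable {k : ℕ} {s : Rotation k} {N : Network k}

/-- Squares of an output and an input, for all components, from a square for one component. -/
theorem exists_squares (h : s.Invariant N) (i : Fin k) {μ ν : Fin k → Act}
    (hμ : ∀ l, μ (s.node l) = (μ l).map s.name) (hν : ∀ l, ν (s.node l) = (ν l).map s.name)
    {Q₀ R₀ S₀ : Proc 0} (hQ : Trans (N.comp i) (μ i) Q₀) (hR : Trans (N.comp i) (ν i) R₀)
    (hQS : Trans Q₀ (ν i) S₀) (hRS : Trans R₀ (μ i) S₀) :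
    ∃ Q R S : Fin k → Proc 0, Q i = Q₀ ∧ R i = R₀ ∧ S i = S₀ ∧
      (∀ l, Q (s.node l) = (Q l).mapNames s.name) ∧ (∀ l, R (s.node l) = (R l).mapNames s.name) ∧
      (∀ l, S (s.node l) = (S l).mapNames s.name) ∧
      ∀ l, Trans (N.comp l) (μ l) (Q l) ∧ Trans (N.comp l) (ν l) (R l) ∧
        Trans (Q l) (ν l) (S l) ∧ Trans (R l) (μ l) (S l) := by
  obtain ⟨Q, hQi, hQ'⟩ := s.exists_family s.mapNames_iterate i Q₀
  obtain ⟨R, hRi, hR'⟩ := s.exists_family s.mapNames_iterate i R₀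
  obtain ⟨S, hSi, hS'⟩ := s.exists_family s.mapNames_iterate i S₀
  refine ⟨Q, R, S, hQi, hRi, hSi, hQ', hR', hS', s.induct i ?_ fun l hl => ?_⟩
  · rw [hQi, hRi, hSi]
    exact ⟨hQ, hR, hQS, hRS⟩
  · rw [hQ', hR', hS', hμ, hν]
    exact ⟨h.trans_node hl.1, h.trans_node hl.2.1, hl.2.2.1.mapNames s.name.injective,
      hl.2.2.2.mapNames s.name.injective⟩

/-- If the sender `e` has already received in this round, its output is the side of the square from
`R` to `S`; otherwise it is the side from `P` to `Q`. -/
theorem square_self {τ : Equiv.Perm (Fin k)} {P Q R S : Fin k → Proc 0} {A : Finset (Fin k)}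
    {e : Fin k} {μ ν : Fin k → Act} (he : e ∉ A)
    (hT : ∀ l, Trans (P l) (μ l) (Q l) ∧ Trans (P l) (ν l) (R l) ∧
      Trans (Q l) (ν l) (S l) ∧ Trans (R l) (μ l) (S l)) :
    Trans (square τ P Q R S A e) (μ e) (if τ.symm e ∈ A then S e else Q e) := by
  simp only [square, if_neg he]
  split_ifs
  exacts [(hT e).2.2.2, (hT e).1]

theorem square_shift {τ : Equiv.Perm (Fin k)} {P Q R S : Fin k → Proc 0} {A : Finset (Fin k)}
    {e : Fin k} {μ ν : Fin k → Act} (he : e ∉ A)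
    (hT : ∀ l, Trans (P l) (μ l) (Q l) ∧ Trans (P l) (ν l) (R l) ∧
      Trans (Q l) (ν l) (S l) ∧ Trans (R l) (μ l) (S l)) :
    Trans (square τ P Q R S A (τ e)) (ν (τ e)) (if τ e ∈ A then S (τ e) else R (τ e)) := by
  simp only [square, Equiv.symm_apply_apply, if_neg he]
  split_ifs
  exacts [(hT (τ e)).2.2.1, (hT (τ e)).2.1]

theorem symm_node {τ : Equiv.Perm (Fin k)} (hτ : ∀ l, τ (s.node l) = s.node (τ l)) (l : Fin k) :
    τ.symm (s.node l) = s.node (τ.symm l) := by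
  rw [Equiv.symm_apply_eq, hτ, Equiv.apply_symm_apply]

/-- Component `l` receives from `τ.symm l`, so its input carries the channel and the name that this
sender transmits. The channels are bound, hence different from `out`, and nothing is announced. -/
theorem round_com (h : s.Invariant N) {i j : Fin k} (hij : i ≠ j) {x y : Name} (hx : x ∈ N.bound)
    (hi : (N.comp j).CanIn (.free x)) (ho : (N.comp i).CanOut (.free x) (.free y)) :
    s.HasRound N := by
  obtain ⟨τ, hτi, hτ, hτne⟩ := exists_shift s hij
  have hτs := symm_node hτ
  obtain ⟨xs, hxi, hxs⟩ := s.exists_family s.name_iterate i x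
  obtain ⟨ys, hyi, hys⟩ := s.exists_family s.name_iterate i y
  have hxb : ∀ l, xs l ∈ N.bound :=
    s.induct i (hxi ▸ hx) fun l hl => by rwa [hxs, ← h.bound]
  have hin : ∀ l, (N.comp l).CanIn (.free (xs (τ.symm l))) := by
    refine s.induct j ?_ fun l hl => ?_
    · rwa [← hτi, Equiv.symm_apply_apply, hxi, hτi]
    · rw [hτs, hxs, h.comp]
      exact hl.mapNames _
  obtain ⟨Q₀, R₀, S₀, h1, h2, h3, h4⟩ := exists_square_out (h.isSeparate i) (hin i) ho
    (ys (τ.symm i))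
  obtain ⟨Q, R, S, -, -, -, hQ, hR, hS, hT⟩ := h.exists_squares i
    (μ := fun l => .out (xs l) (ys l)) (ν := fun l => .inp (xs (τ.symm l)) (ys (τ.symm l)))
    (fun l => by simp only [hxs, hys, Act.map]) (fun l => by simp only [hτs, hxs, hys, Act.map])
    (by rw [hxi, hyi]; exact h1) h2 h3 (by rw [hxi, hyi]; exact h4)
  obtain ⟨l, N', hr, ⟨hc, hbd⟩, hne, hp⟩ := Run.exists_of_steps (N := N)
    (Good := fun A N' => N'.comp = square τ N.comp Q R S A ∧ N'.bound = N.bound)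
    (p := fun e _ c => c = double e (.out (xs e) (ys e)) (τ e) (.inp (xs e) (ys e)))
    (by refine ⟨?_, rfl⟩; funext m; simp [square])
    (fun A N' e hg he => by
      have hso := square_self (τ := τ) he hT
      have hsi := square_shift (τ := τ) he hT
      rw [← hg.1] at hso hsi
      rw [Equiv.symm_apply_apply] at hsi
      refine ⟨.tau, _, _, Network.step_com (hτne e).symm hso hsi, ⟨?_, hg.2⟩, rfl⟩
      simp only [Network.withComp]
      rw [hg.1, update_square he (hτne e)])
  have hc : N'.comp = S := by rw [hc]; funext m; simp [square]
  refine ⟨l, N', hr, ?_, ⟨fun m => ?_, fun m => ?_, fun z => ?_⟩, ?_⟩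
  · rintro rfl
    simpa using hne i
  · rw [hc]; exact (hT m).2.2.1.isSeparate ((hT m).1.isSeparate (h.isSeparate m))
  · rw [hc]; exact hS m
  · rw [hbd]; exact h.bound z
  · intro t ht j n hn
    obtain ⟨e, he⟩ := hp t ht
    rw [he] at hn
    rcases double_eq_some hn with e' | e'
    · simp only [Act.out.injEq] at e'
      have := N.bound_isVar _ (hxb e)
      rw [← e'.1] at this
      exact this.elim
    · cases e'

/-- Each of the `k` communications extrudes a fresh name of its own, which joins the global bound
names. The new names form an orbit, so the enlarged set of bound names is again invariant. -/
theorem round_close (h : s.Invariant N) {i j : Fin k} (hij : i ≠ j) {x : Name}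
    (hi : (N.comp j).CanIn (.free x)) (ho : (N.comp i).CanBOut (.free x)) :
    s.HasRound N := by
  obtain ⟨τ, hτi, hτ, hτne⟩ := exists_shift s hij
  have hτs := symm_node hτ
  obtain ⟨xs, hxi, hxs⟩ := s.exists_family s.name_iterate i x
  obtain ⟨ys, hinj, hys, hyv, hyb, hyf, hyx⟩ := exists_fresh s N {x}
  have hin : ∀ l, (N.comp l).CanIn (.free (xs (τ.symm l))) := by
    refine s.induct j ?_ fun l hl => ?_
    · rwa [← hτi, Equiv.symm_apply_apply, hxi, hτi]
    · rw [hτs, hxs, h.comp]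
      exact hl.mapNames _
  have hτsi : τ.symm i ≠ i := fun e => hτne i (by rw [← e, Equiv.apply_symm_apply, e])
  obtain ⟨Q₀, R₀, S₀, h1, h2, h3, h4, h5, h6, h7⟩ := exists_square_bout (h.isSeparate i) (hin i) ho
    (w := ys (τ.symm i)) (z := ys i) (hyf i i) (by simpa using hyx i)
    (hinj.ne hτsi.symm)
  obtain ⟨Q, R, S, hQi, hRi, hSi, hQ, hR, hS, hT⟩ := h.exists_squares i
    (μ := fun l => .bout (xs l) (ys l)) (ν := fun l => .inp (xs (τ.symm l)) (ys (τ.symm l)))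
    (fun l => by simp only [hxs, hys, Act.map]) (fun l => by simp only [hτs, hxs, hys, Act.map])
    (by rw [hxi]; exact h1) h2 h3 (by rw [hxi]; exact h4)
  have hfn : ∀ l, (Q l).fn ⊆ insert (ys l) (N.comp l).fn ∧
      (R l).fn ⊆ insert (ys (τ.symm l)) (N.comp l).fn ∧
      (S l).fn ⊆ insert (ys (τ.symm l)) (insert (ys l) (N.comp l).fn) := by
    refine s.induct i ?_ fun l hl => ?_
    · rw [hQi, hRi, hSi]
      exact ⟨h5, h6, h7⟩
    · simp only [hQ, hR, hS, hτs, hys, h.comp, Proc.fn_mapNames, ← Finset.image_insert]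
      exact ⟨Finset.image_subset_image hl.1, Finset.image_subset_image hl.2.1,
        Finset.image_subset_image hl.2.2⟩
  -- The name of `e` can enter a component only when `e` sends it, and this has not happened while
  -- `e` is outside `A`.
  have hfresh : ∀ A e l, e ∉ A → ys e ∉ (square τ N.comp Q R S A l).fn := by
    intro A e l he hm
    have h1 : ∀ m ∈ A, ys e ≠ ys m := fun m hm h' => he (hinj h' ▸ hm)
    have h2 := hyf e l
    have h3 := hfn l
    unfold square at hm
    split_ifs at hm with hl hl' hl'
    · have := h3.2.2 hm
      simp [h1 _ hl, h1 _ hl', h2] at this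
    · have := h3.1 hm
      simp [h1 _ hl, h2] at this
    · have := h3.2.1 hm
      simp [h1 _ hl', h2] at this
    · exact h2 hm
  obtain ⟨l, N', hr, ⟨hc, hbd⟩, hne, hp⟩ := Run.exists_of_steps (N := N)
    (Good := fun A N' => N'.comp = square τ N.comp Q R S A ∧
      ∀ z, z ∈ N'.bound ↔ z ∈ N.bound ∨ ∃ e ∈ A, z = ys e)
    (p := fun e _ c => c = double e (.bout (xs e) (ys e)) (τ e) (.inp (xs e) (ys e)))
    (by refine ⟨?_, by simp⟩; funext m; simp [square])
    (fun A N' e hg he => by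
      have hso := square_self (τ := τ) he hT
      have hsi := square_shift (τ := τ) he hT
      rw [← hg.1] at hso hsi
      rw [Equiv.symm_apply_apply] at hsi
      refine ⟨.tau, _, _, Network.step_close (hτne e).symm hso hsi
        (fun l _ => by rw [hg.1]; exact hfresh A e l he) (fun h' => ?_) (hyv e), ⟨?_, fun z => ?_⟩,
        rfl⟩
      · rcases (hg.2 _).1 h' with h' | ⟨e', he', h'⟩
        · exact hyb e h'
        · exact he (hinj h' ▸ he')
      · simp only [Network.withComp]
        rw [hg.1, update_square he (hτne e)]
      · simp only [Network.withComp, Network.bind, List.mem_append, List.mem_singleton, hg.2,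
          Finset.exists_mem_insert]
        rw [or_assoc, or_comm (b := z = ys e)])
  have hc : N'.comp = S := by rw [hc]; funext m; simp [square]
  refine ⟨l, N', hr, ?_, ⟨fun m => ?_, fun m => ?_, fun z => ?_⟩, ?_⟩
  · rintro rfl
    simpa using hne i
  · rw [hc]; exact (hT m).2.2.1.isSeparate ((hT m).1.isSeparate (h.isSeparate m))
  · rw [hc]; exact hS m
  · rw [hbd, hbd, ← h.bound]
    refine or_congr_right ⟨?_, ?_⟩
    · rintro ⟨e, -, rfl⟩
      exact ⟨s.node e, Finset.mem_univ _, (hys e).symm⟩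
    · rintro ⟨e, -, he⟩
      refine ⟨s.node.symm e, Finset.mem_univ _, s.name.injective ?_⟩
      rw [he, ← hys, Equiv.apply_symm_apply]
  · intro t ht j n hn
    obtain ⟨e, he⟩ := hp t ht
    rw [he] at hn
    rcases double_eq_some hn with e' | e' <;> cases e'

/-- An invariant network that has a step has a round. -/
theorem hasRound (hk : 2 ≤ k) (h : s.Invariant N) {μ : Act} {c : Fin k → Option Act}
    {N' : Network k} (hs : N.Step μ c N') : s.HasRound N := by
  rcases hs.cases_active with ⟨i, Q, hQ⟩ | ⟨i, x, hx, hc⟩ | ⟨i, x, y, hx, hc⟩ | ⟨i, x, hx, hc⟩ |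
    ⟨i, j, x, hij, hx, hc, ⟨y, ho⟩ | ho⟩
  · exact h.round_tau hQ
  · exact h.round_in hx hc
  · exact h.round_out hk hx hc
  · exact h.round_bout hx hc
  · exact h.round_com hij hx hc ho
  · exact h.round_close hij hc ho

end Rotation.Invariant

/-! ### Computations from runs -/

/-- The `m`-th network of a run from `N`. -/
def netAt {k : ℕ} (N : Network k) (l : List (Entry k)) : ℕ → Network k
  | 0 => N
  | m + 1 => (l[m]?.map fun t => t.2.2).getD N

theorem Run.netAt_length {k : ℕ} {N N' : Network k} {l : List (Entry k)} (h : Run N l N') :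
    netAt N l l.length = N' := by
  cases h with
  | nil => rfl
  | snoc => simp [netAt]

theorem netAt_append {k : ℕ} {N : Network k} {l l' : List (Entry k)} {m : ℕ} (hm : m ≤ l.length) :
    netAt N (l ++ l') m = netAt N l m := by
  cases m with
  | zero => rfl
  | succ m => simp [netAt, List.getElem?_append_left (show m < l.length by omega)]

theorem Run.step {k : ℕ} {N N' : Network k} {l : List (Entry k)} (h : Run N l N') {m : ℕ}
    (hm : m < l.length) : (netAt N l m).Step l[m].1 l[m].2.1 (netAt N l (m + 1)) := by
  induction h with
  | nil => simp at hm
  | @snoc l N' N'' μ c h hs ih =>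
    rw [List.length_append, List.length_singleton] at hm
    rcases Nat.lt_succ_iff_lt_or_eq.1 hm with hm | rfl
    · have := ih hm
      rwa [netAt_append hm.le, netAt_append hm, List.getElem_append_left hm]
    · rw [netAt_append le_rfl, h.netAt_length]
      simpa [netAt] using hs

theorem getElem?_eq_of_prefix {α : Type*} {l l' : List α} (h : l <+: l') {m : ℕ}
    (hm : m < l.length) : l'[m]? = l[m]? := by
  obtain ⟨r, rfl⟩ := h
  exact List.getElem?_append_left hm

theorem netAt_of_prefix {k : ℕ} {N : Network k} {l l' : List (Entry k)} (h : l <+: l') {m : ℕ}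
    (hm : m ≤ l.length) : netAt N l' m = netAt N l m := by
  obtain ⟨r, rfl⟩ := h
  exact netAt_append hm

namespace Network.Computation

variable {k : ℕ} {P : Network k}

/-- The computation that follows an increasing sequence of runs. -/
def ofRuns (L : ℕ → List (Entry k)) (len : ℕ∞) (hL : ∀ m, ∃ N', Run P (L m) N')
    (hp : ∀ m, L m <+: L (m + 1)) (hlen : ∀ m : ℕ, (m : ℕ∞) ≤ len → m ≤ (L m).length) :
    P.Computation where
  len := len
  net m := netAt P (L m) m
  -- Step `m` is read from `L (m + 1)`, the first run that is certain to contain it. The default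
  -- values are only reached beyond `len`.
  label m := ((L (m + 1))[m]?.map fun t => t.1).getD .tau
  contrib m := ((L (m + 1))[m]?.map fun t => t.2.1).getD fun _ => none
  net_zero := rfl
  step m hm := by
    have h1 : m < (L (m + 1)).length :=
      hlen (m + 1) (by push_cast; exact Order.add_one_le_of_lt hm)
    obtain ⟨N', hN'⟩ := hL (m + 1)
    have := hN'.step h1
    rw [netAt_of_prefix (hp m) (hlen m hm.le)] at this
    simpa [List.getElem?_eq_getElem h1] using this

/-- A computation that cannot be continued, and in which no leader is elected, refutes an
election. -/
theorem not_isElectoral (hk : 0 < k) (C : P.Computation)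
    (hC : ∀ m : ℕ, (m : ℕ∞) < C.len → ∀ i n : Fin k, C.contrib m i = some (.out .out (.num n)) →
      ∃ n' : ℕ, n' ≠ n ∧ C.Contains (.out .out (.num n')))
    (hstuck : ∀ q : ℕ, C.len = q → ∀ μ c N', ¬ (C.net q).Step μ c N') : ¬ P.IsElectoral := by
  intro h
  obtain ⟨C', ⟨hle, hext⟩, n, hn, hno⟩ := h C
  have hlen : C'.len = C.len := by
    -- A longer extension would make a step from the last network of `C`, which has none.
    refine le_antisymm (not_lt.1 fun hlt => ?_) hle
    obtain ⟨q, hq⟩ := ENat.ne_top_iff_exists.1 hlt.ne_top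
    have hnet : C'.net q = C.net q := by
      cases q with
      | zero => rw [C'.net_zero, C.net_zero]
      | succ q =>
        refine (hext q ?_).2.2
        rw [← hq]
        exact_mod_cast Nat.lt_succ_self q
    have := C'.step q (hq ▸ hlt)
    rw [hnet] at this
    exact hstuck q hq.symm _ _ _ this
  obtain ⟨m, hm, hc⟩ := hn ⟨0, hk⟩
  rw [hlen] at hm
  rw [(hext m hm).2.1] at hc
  -- The contradicting announcement already occurs in `C`, so `C'` as an extension of itself
  -- violates the uniqueness of the leader.
  obtain ⟨n', hne, m', hm', hl⟩ := hC m hm _ _ hc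
  exact hno C' ⟨le_rfl, fun _ _ => ⟨rfl, rfl, rfl⟩⟩ n' hne
    ⟨m', hlen ▸ hm', (hext m' hm').1.trans hl⟩

/-- A computation along runs without decision elects no leader. -/
theorem ofRuns_undecided {L : ℕ → List (Entry k)} {len : ℕ∞} {hL : ∀ m, ∃ N', Run P (L m) N'}
    {hp : ∀ m, L m <+: L (m + 1)} {hlen : ∀ m : ℕ, (m : ℕ∞) ≤ len → m ≤ (L m).length}
    (hlen' : ∀ m, ((L m).length : ℕ∞) ≤ len) (hU : ∀ m, Undecided (L m)) (m : ℕ)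
    (hm : (m : ℕ∞) < len) (i n : Fin k)
    (hc : (ofRuns L len hL hp hlen).contrib m i = some (.out .out (.num n))) :
    ∃ n' : ℕ, n' ≠ n ∧ (ofRuns L len hL hp hlen).Contains (.out .out (.num n')) := by
  have hlt : ∀ m : ℕ, (m : ℕ∞) < len → m < (L (m + 1)).length := fun m hm =>
    hlen (m + 1) (by push_cast; exact Order.add_one_le_of_lt hm)
  have hmono : ∀ a b, a ≤ b → L a <+: L b := fun a b hab => by
    induction hab with
    | refl => exact List.prefix_rfl
    | step _ ih => exact ih.trans (hp _)
  have h1 := hlt m hm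
  simp only [ofRuns, List.getElem?_eq_getElem h1, Option.map_some, Option.getD_some] at hc
  obtain ⟨n', hne, t', ht', hl⟩ := hU (m + 1) _ (List.getElem_mem h1) i n hc
  obtain ⟨m', hm', rfl⟩ := List.mem_iff_getElem.1 ht'
  have hm'' : (m' : ℕ∞) < len := lt_of_lt_of_le (by exact_mod_cast hm') (hlen' (m + 1))
  refine ⟨n', hne, m', hm'', ?_⟩
  have e : (L (m' + 1))[m']? = (L (m + 1))[m']? := by
    rcases le_total (m + 1) (m' + 1) with h | h
    · exact getElem?_eq_of_prefix (hmono _ _ h) hm'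
    · exact (getElem?_eq_of_prefix (hmono _ _ h) (hlt m' hm'')).symm
  simp only [ofRuns, e, List.getElem?_eq_getElem hm', Option.map_some, Option.getD_some, hl]

end Network.Computation

open Network.Computation in
/-- A network that is invariant under a rotation is not an electoral system. -/
theorem Rotation.Invariant.not_isElectoral {k : ℕ} {s : Rotation k} {P : Network k} (hk : 2 ≤ k)
    (h : s.Invariant P) : ¬ P.IsElectoral := by
  by_cases hs : ∃ l N', Run P l N' ∧ s.Invariant N' ∧ Undecided l ∧ ∀ μ c N'', ¬ N'.Step μ c N''
  · obtain ⟨l, N', hr, -, hU, hstuck⟩ := hs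
    -- The finite case is the constant sequence of runs, with a length that stops at the network
    -- without steps.
    refine Network.Computation.not_isElectoral (by omega)
      (ofRuns (fun _ => l) l.length (fun _ => ⟨N', hr⟩) (fun _ => List.prefix_rfl)
        fun m hm => by exact_mod_cast hm)
      (ofRuns_undecided (fun _ => le_rfl) fun _ => hU) fun q hq => ?_
    have hq : l.length = q := ENat.natCast_inj.1 hq
    subst hq
    simpa only [ofRuns, hr.netAt_length] using hstuck
  · push Not at hs
    -- Every invariant undecided run can now be prolonged by a nonempty round; iteration gives runs
    -- of unbounded length, each a prefix of the next.
    let G := {l : List (Entry k) // ∃ N', Run P l N' ∧ s.Invariant N' ∧ Undecided l}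
    have hnext : ∀ l : G, ∃ l' : G, l.1 <+: l'.1 ∧ l.1.length < l'.1.length := by
      rintro ⟨l, N', hr, hi, hU⟩
      obtain ⟨μ, c, N'', hstep⟩ := hs l N' hr hi hU
      obtain ⟨r, M, hr', hne, hi', hU'⟩ := hi.hasRound hk hstep
      refine ⟨⟨l ++ r, M, hr.append hr', hi', hU.append hU'⟩, List.prefix_append _ _, ?_⟩
      simpa using List.length_pos_iff.2 hne
    choose next hpre hlt using hnext
    let L : ℕ → G := fun n => next^[n] ⟨[], P, .nil, h, fun t ht => by simp at ht⟩
    have hL : ∀ n, L (n + 1) = next (L n) := fun n => Function.iterate_succ_apply' _ _ _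
    have hlen : ∀ n, n ≤ (L n).1.length := fun n => by
      induction n with
      | zero => exact Nat.zero_le _
      | succ n ih => rw [hL]; exact lt_of_le_of_lt ih (hlt _)
    refine Network.Computation.not_isElectoral (by omega)
      (ofRuns (fun n => (L n).1) ⊤ (fun n => (L n).2.imp fun _ h => h.1)
        (fun n => by rw [hL]; exact hpre _) fun m _ => hlen m)
      (ofRuns_undecided (fun _ => le_top) fun n => (L n).2.elim fun _ h => h.2.2) fun q hq => ?_
    exact absurd hq.symm (ENat.natCast_ne_top q)

-- Extension of the automorphism to a rotation of all names

namespace Network.Automorphism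

variable {k : ℕ} {N : Network k} (σ : N.Automorphism)

theorem onName_mem {a : Name} (h : a ∈ N.chans) : σ.onName a ∈ N.chans := by
  simp only [onName, h, dif_pos]
  exact (σ.edge ⟨a, h⟩).2

theorem iterate_onName_mem {a : Name} (h : a ∈ N.chans) (j : ℕ) : σ.onName^[j] a ∈ N.chans := by
  induction j with
  | zero => exact h
  | succ j ih => rw [Function.iterate_succ_apply']; exact σ.onName_mem ih

theorem isCycleOn_node (hσ : σ.HasSingleOrbit) :
    σ.node.IsCycleOn (Finset.univ : Finset (Fin k)) := by
  refine ⟨by simp, fun i _ j _ => ?_⟩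
  have : j ∈ σ.toAutomorphism.orbit i := by rw [hσ i]; trivial
  obtain ⟨n, hn⟩ := this
  exact ⟨n, by simpa using hn⟩

theorem node_pow (hσ : σ.HasSingleOrbit) : σ.node ^ k = 1 := by
  ext i
  have := (σ.isCycleOn_node hσ).pow_card_apply (Finset.mem_univ i)
  rw [Finset.card_fin] at this
  simp [this]

theorem comp_pow (hsym : N.IsSymmetric σ) (i : Fin k) (j : ℕ) :
    N.comp ((σ.node ^ j) i) = (N.comp i).mapNames (σ.onName^[j]) := by
  induction j with
  | zero => simp
  | succ j ih =>
    rw [pow_succ', Equiv.Perm.mul_apply, hsym, ih, Proc.mapNames_mapNames,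
      ← Function.iterate_succ']

/-- A full turn of the cycle brings component `i` back, so renaming it by the `k`-th iterate leaves
it unchanged. As terms are alpha-equivalence classes, this iterate fixes each of its free names. -/
theorem iterate_onName (hσ : σ.HasSingleOrbit) (hsym : N.IsSymmetric σ) {a : Name}
    (h : a ∈ N.chans) : σ.onName^[k] a = a := by
  obtain ⟨i, hi⟩ := mem_fn_parAll.1 (Finset.mem_of_mem_erase h)
  have := σ.comp_pow hsym i k
  rw [σ.node_pow hσ, Equiv.Perm.one_apply] at this
  conv_lhs at this => rw [← Proc.mapNames_id (N.comp i)]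
  exact (Proc.eq_of_mapNames_eq this hi).symm

end Network.Automorphism

/-- A bound for the indices of the ordinary names in a finite set. -/
def Name.height : Name → ℕ
  | .var v => v + 1
  | _ => 0

theorem Name.lt_sup_height {F : Finset Name} {v : ℕ} (h : Name.var v ∈ F) :
    v < F.sup Name.height :=
  Finset.le_sup (f := Name.height) h

/-- A bound for the indices of the ordinary names of a network. -/
def Network.top {k : ℕ} (N : Network k) : ℕ := (N.chans ∪ N.bound.toFinset).sup Name.height

theorem Network.lt_top_of_mem_chans {k : ℕ} {N : Network k} {v : ℕ} (h : Name.var v ∈ N.chans) :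
    v < N.top :=
  Name.lt_sup_height (Finset.mem_union_left _ h)

theorem Network.lt_top_of_mem_bound {k : ℕ} {N : Network k} {v : ℕ} (h : Name.var v ∈ N.bound) :
    v < N.top :=
  Name.lt_sup_height (Finset.mem_union_right _ (List.mem_toFinset.2 h))

theorem bijective_of_iterate_eq_id {α : Type*} {f : α → α} {n : ℕ} (hn : n ≠ 0)
    (h : f^[n] = id) : Function.Bijective f := by
  obtain ⟨n, rfl⟩ := Nat.exists_eq_succ_of_ne_zero hn
  constructor
  · rw [Function.iterate_succ] at h
    exact Function.Injective.of_comp (f := f^[n]) (h ▸ Function.injective_id)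
  · rw [Function.iterate_succ'] at h
    exact Function.Surjective.of_comp (g := f^[n]) (h ▸ Function.surjective_id)

section Extension

variable {k : ℕ} [NeZero k] {N : Network k} (σ : N.Automorphism)

/-- The `(q, r)`-th name beyond the names of the network. -/
def Network.spare (N : Network k) (q : ℕ) (r : Fin k) : ℕ :=
  N.top + (Nat.divModEquiv k).symm (q, r)

/-- An extension of an automorphism to all the names. It permutes the numbers below `k` in the same
way as the nodes, and it acts on the names beyond those of the network by `k`-cycles. -/
def Network.Automorphism.extend : Name → Name
  | .out => .out
  -- A number below `k` may be announced although it is not free in the initial network, for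
  -- instance after it has been received; it still has to move together with the nodes.
  | .num n => if h : n < k then .num (σ.node ⟨n, h⟩) else σ.onName (.num n)
  | .var v =>
    if v < N.top then σ.onName (.var v)
    else .var (N.spare (Nat.divModEquiv k (v - N.top)).1 (σ.node (Nat.divModEquiv k (v - N.top)).2))

namespace Network.Automorphism

theorem extend_num (n : Fin k) : σ.extend (.num n) = .num (σ.node n) := by
  simp [extend]

theorem extend_spare (q : ℕ) (r : Fin k) :
    σ.extend (.var (N.spare q r)) = .var (N.spare q (σ.node r)) := by
  have h : ¬ N.spare q r < N.top := by simp [spare]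
  have h' : N.spare q r - N.top =
    (Nat.divModEquiv k).symm (q, r) := by simp [spare]
  simp only [extend, if_neg h, h', Equiv.apply_symm_apply]

theorem extend_of_mem {a : Name} (h : a ∈ N.chans) : σ.extend a = σ.onName a := by
  cases a with
  | out => simp [chans] at h
  | num n =>
    by_cases hn : n < k
    · rw [σ.extend_num ⟨n, hn⟩, ← σ.edge_num ⟨n, hn⟩ h]
      simp [onName, h]
    · simp [extend, hn]
  | var v =>
    simp only [extend, if_pos (lt_top_of_mem_chans h)]

theorem exists_spare_eq {v : ℕ} (h : ¬ v < N.top) :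
    ∃ q r, v = N.spare q r := by
  refine ⟨(Nat.divModEquiv k (v - N.top)).1,
    (Nat.divModEquiv k (v - N.top)).2, ?_⟩
  rw [spare, Prod.mk.eta, Equiv.symm_apply_apply]
  omega

/-- Free names return by symmetry, numbers below `k` and spare names return because the node cycle
has length `k`, and all other names are fixed. Bijectivity of the extension is a consequence and
needs no separate treatment. -/
theorem iterate_extend (hσ : σ.HasSingleOrbit) (hsym : N.IsSymmetric σ) : σ.extend^[k] = id := by
  have hnode : ∀ i, (σ.node ^ k) i = i := fun i => by rw [σ.node_pow hσ, Equiv.Perm.one_apply]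
  have hchan : ∀ a ∈ N.chans, σ.extend^[k] a = a := fun a ha => by
    have : ∀ j, σ.extend^[j] a = σ.onName^[j] a := fun j => by
      induction j with
      | zero => rfl
      | succ j ih =>
        rw [Function.iterate_succ_apply', ih, σ.extend_of_mem (σ.iterate_onName_mem ha j),
          Function.iterate_succ_apply']
    rw [this, σ.iterate_onName hσ hsym ha]
  have hfix : ∀ a, a ∉ N.chans → σ.extend a = σ.onName a → σ.extend^[k] a = a := fun a ha h => by
    refine Function.iterate_fixed ?_ k
    rw [h]; simp [onName, ha]
  funext a
  by_cases ha : a ∈ N.chans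
  · exact hchan a ha
  cases a with
  | out => exact Function.iterate_fixed rfl k
  | num n =>
    by_cases hn : n < k
    · have : ∀ j, σ.extend^[j] (.num n) = .num ((σ.node ^ j) ⟨n, hn⟩) := fun j => by
        induction j with
        | zero => rfl
        | succ j ih =>
          rw [Function.iterate_succ_apply', ih, σ.extend_num, pow_succ', Equiv.Perm.mul_apply]
      rw [this, hnode]; rfl
    · exact hfix _ ha (by simp [extend, hn])
  | var v =>
    by_cases hv : v < N.top
    · exact hfix _ ha (by simp only [extend, if_pos hv])
    · obtain ⟨q, r, rfl⟩ := exists_spare_eq hv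
      have : ∀ j, σ.extend^[j] (.var (N.spare q r)) = .var (N.spare q ((σ.node ^ j) r)) := fun j => by
        induction j with
        | zero => rfl
        | succ j ih =>
          rw [Function.iterate_succ_apply', ih, σ.extend_spare, pow_succ', Equiv.Perm.mul_apply]
      rw [this, hnode]; rfl

theorem extend_bijective (hσ : σ.HasSingleOrbit) (hsym : N.IsSymmetric σ) :
    Function.Bijective σ.extend :=
  bijective_of_iterate_eq_id (NeZero.ne k) (σ.iterate_extend hσ hsym)

/-- The rotation that extends an automorphism with a single orbit. -/
noncomputable def rotation (hσ : σ.HasSingleOrbit) (hsym : N.IsSymmetric σ) : Rotation k where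
  node := σ.node
  name := Equiv.ofBijective σ.extend (σ.extend_bijective hσ hsym)
  isCycleOn := σ.isCycleOn_node hσ
  name_pow := by
    refine Equiv.ext fun a => ?_
    rw [Equiv.Perm.coe_pow]
    exact congrFun (σ.iterate_extend hσ hsym) a
  name_out := rfl
  name_num n := σ.extend_num n
  fresh F := by
    -- Block `q` of the spare names consists of indices that are at least `q * k ≥ q`, so taking for
    -- `q` a bound on the indices in `F` avoids `F`.
    refine ⟨fun r => .var (N.spare (F.sup Name.height) r), fun r r' h => ?_,
      fun i => (σ.extend_spare _ _).symm, fun i h => ?_, fun i => trivial⟩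
    · simpa [spare, Fin.ext_iff] using h
    · have h1 := Name.lt_sup_height h
      have h2 : F.sup Name.height ≤ (Nat.divModEquiv k).symm (F.sup Name.height, i) := by
        simp only [Nat.divModEquiv_symm_apply]
        have := Nat.pos_of_ne_zero (NeZero.ne k)
        nlinarith [Nat.zero_le (F.sup Name.height)]
      simp only [spare] at h1
      omega

theorem invariant_rotation (hσ : σ.HasSingleOrbit) (hsym : N.IsSymmetric σ) (hN : N.IsSeparate) :
    (σ.rotation hσ hsym).Invariant N where
  isSeparate := hN
  comp i := by
    refine (hsym i).trans (Proc.mapNames_congr fun a ha => ?_)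
    change σ.onName a = σ.extend a
    by_cases hc : a ∈ N.chans
    · exact (σ.extend_of_mem hc).symm
    · obtain rfl : a = .out := by
        by_contra h
        exact hc (Finset.mem_erase.2 ⟨h, mem_fn_parAll.2 ⟨i, ha⟩⟩)
      simp [onName, hc, extend]
  bound a := by
    change a ∈ N.bound ↔ σ.extend a ∈ N.bound
    by_cases hc : a ∈ N.chans
    · rw [σ.extend_of_mem hc]
      simpa [onName, hc] using σ.edge_bound ⟨a, hc⟩
    -- A bound name that is not free in any component lies below `N.top` and is fixed; numbers and
    -- spare names are never bound.
    have hfix : σ.extend a = σ.onName a → (a ∈ N.bound ↔ σ.extend a ∈ N.bound) := fun h => by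
      rw [h]; simp [onName, hc]
    have hnum : ∀ n, Name.num n ∉ N.bound := fun n h => N.bound_isVar _ h
    cases a with
    | out => rfl
    | num n =>
      by_cases hn : n < k
      · rw [σ.extend_num ⟨n, hn⟩]
        exact iff_of_false (hnum _) (hnum _)
      · exact hfix (by simp [extend, hn])
    | var v =>
      by_cases hv : v < N.top
      · exact hfix (by simp only [extend, if_pos hv])
      · obtain ⟨q, r, rfl⟩ := exists_spare_eq hv
        have hsp : ∀ r, Name.var (N.spare q r) ∉ N.bound := fun r h => by
          have := lt_top_of_mem_bound h
          simp [spare] at this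
        rw [σ.extend_spare]
        exact iff_of_false (hsp _) (hsp _)

end Network.Automorphism

end Extension

end PiCalc

theorem mainTheorem1 (k : ℕ) (hk : 2 ≤ k) (P : PiCalc.Network k) (hP : P.IsSeparate)
    (σ : P.Automorphism) (hσ : σ.HasSingleOrbit) (hsym : P.IsSymmetric σ) :
    ¬ P.IsElectoral := by
  have : NeZero k := ⟨by omega⟩
  exact (σ.invariant_rotation hσ hsym hP).not_isElectoral hk
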